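/- Fix $c_o>0$, $\xi>0$, $\alpha\in(-\pi/2,\pi/2)$ and $\xi_o>-\xi\cos\alpha$. For $L>0$ let $n_L(t,\boldsymbol y)$ be a real zero-mean noise source, stationary in time and delta-correlated in space, carried by the half-sphere $\partial B_+(0,L)=\{\boldsymbol y=(x,y,z): z>0,\ |\boldsymbol y|=L\}$: $$\langle n_L(t,\boldsymbol y)n_L(t',\boldsymbol y')\rangle=F(t-t')\,\delta(\boldsymbol y-\boldsymbol y')\,\delta_{\partial B_+(0,L)}(\boldsymbol y),$$ where $\delta_{\partial B_+(0,L)}$ is the surface measure, and where $F$ is real-valued with integrable real power spectral density $\hat F$, that is $F(t)=\frac1{2\pi}\int_{\mathbb R}\hat F(\omega)e^{-i\omega t}d\omega$ with $\hat F\in L^1(\mathbb R)$. Let $u_L$ be the causal (outgoing) mean-square solution of $$\frac1{c_o^2}\partial_t^2u_L-\Delta u_L=n_L\ \text{ in }\ \mathbb R\times\mathbb R^2\times(0,\infty),\qquad u_L|_{z=0}=0 .$$ An observer follows the Rindler trajectory $$T(\tau)=\frac{\xi}{c_o}\sinh\frac{c_o\tau}{\xi},\qquad \boldsymbol X(\tau)=(0,0,\xi_o)+\xi\cosh\Big(\frac{c_o\tau}{\xi}\Big)(\sin\alpha,0,\cos\alpha),$$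 with mirror image $\boldsymbol X^{\rm s}(\tau)=(0,0,-\xi_o)+\xi\cosh(c_o\tau/\xi)(\sin\alpha,0,-\cos\alpha)$ in the plane $z=0$, and records $U_L(\tau)=u_L(T(\tau),\boldsymbol X(\tau))$. For $\tau,\tau'\in\mathbb R$ put $$t=T\big(\tau+\tfrac{\tau'}2\big)-T\big(\tau-\tfrac{\tau'}2\big),\quad d=\big|\boldsymbol X\big(\tau+\tfrac{\tau'}2\big)-\boldsymbol X\big(\tau-\tfrac{\tau'}2\big)\big|,\quad d^{\rm s}=\big|\boldsymbol X^{\rm s}\big(\tau+\tfrac{\tau'}2\big)-\boldsymbol X\big(\tau-\tfrac{\tau'}2\big)\big| .$$ Then, with ${\rm sinc}(s)=\sin(s)/s$ and ${\rm sinc}(0)=1$, $$\lim_{L\to\infty}\Big\langle U_L\big(\tau+\tfrac{\tau'}2\big)U_L\big(\tau-\tfrac{\tau'}2\big)\Big\rangle=\frac1{8\pi^2}\int_{\mathbb R}\hat F(\omega)\,{\rm sinc}\Big(\frac{\omega}{c_o}d\Big)e^{i\omega t}d\omega-\frac1{8\pi^2}\int_{\mathbb R}\hat F(\omega)\,{\rm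 sinc}\Big(\frac{\omega}{c_o}d^{\rm s}\Big)e^{i\omega t}d\omega ,$$ and this limit is also equal to $$\frac1{8\pi}\int_{-1}^1F\Big(\frac v{c_o}d+t\Big)dv-\frac1{8\pi}\int_{-1}^1F\Big(\frac v{c_o}d^{\rm s}+t\Big)dv .$$ -/

import Mathlib

open MeasureTheory Filter Topology Metric Laplacian
open scoped ContDiff

noncomputable section

/-- Physical space `ℝ³` with its Euclidean norm; the coordinates `(x, y, z)` of a point `p` are
`p 0`, `p 1`, `p 2`. -/
abbrev Space3 : Type := EuclideanSpace ℝ (Fin 3)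

/-- The surface measure of the open half-sphere `{z > 0, |y| = L}` (for `L > 0`), as a measure
on `ℝ³`. The measure `volume.toSphere` is the surface measure of the unit sphere, of total
mass `4π`. -/
def hemisphereMeasure (L : ℝ) : Measure Space3 :=
  (ENNReal.ofReal (L ^ 2) •
    Measure.map (fun y : sphere (0 : Space3) 1 => L • (y : Space3))
      (volume : Measure Space3).toSphere).restrict {y | 0 < y 2}

/-- Space-time functions that can be paired with a source carried by the half-sphere of radius
`L`: continuous, and of bounded time support on that half-sphere. -/
structure IsSourceTest (L : ℝ) (φ : ℝ × Space3 → ℝ) : Prop where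
  continuous : Continuous φ
  time_support : ∃ S : ℝ, ∀ (s : ℝ) (y : Space3),
    ‖y‖ = L → 0 ≤ y 2 → S < |s| → φ (s, y) = 0

/-- `n` is a noise source on the half-sphere of radius `L`: a generalized random field, with
`n φ` in the role of `∫∫ n(s,y) φ(s,y) ds dy`, which has mean zero and covariance
`⟨n(s,y) n(s',y')⟩ = F(s - s') δ(y - y') K(y)`, where `K` is the surface measure of the
half-sphere. Random variables are elements of `L²(P)`. -/
structure IsNoiseSource {Ω : Type*} [MeasurableSpace Ω] (P : Measure Ω) (F : ℝ → ℝ) (L : ℝ)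
    (n : (ℝ × Space3 → ℝ) → Lp ℝ 2 P) : Prop where
  mean_zero : ∀ φ, IsSourceTest L φ → ∫ a, n φ a ∂P = 0
  covariance : ∀ φ ψ, IsSourceTest L φ → IsSourceTest L ψ →
    ∫ a, n φ a * n ψ a ∂P =
      ∫ y, (∫ s, ∫ s', F (s - s') * φ (s, y) * ψ (s', y)) ∂(hemisphereMeasure L)

/-- The wave operator `c⁻² ∂ₜ² - Δ`. -/
def waveOp (c : ℝ) (w : ℝ × Space3 → ℝ) (p : ℝ × Space3) : ℝ :=
  1 / c ^ 2 * iteratedDeriv 2 (fun s => w (s, p.2)) p.1 - Δ (fun y => w (p.1, y)) p.2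

/-- `u` is the causal (outgoing) wave field in the half-space `{z > 0}`, with Dirichlet condition
on the plane `{z = 0}`, emitted by the source `n` on the half-sphere of radius `L`.

The field is mean-square continuous off the source surface (its variance diverges
logarithmically on it), locally integrable across it, and zero on the plane. The equation
`c⁻² ∂ₜ² u - Δ u = n` is meant in the weak sense: `∫∫ u (c⁻² ∂ₜ² w - Δ w) = n w`, where the smooth
test functions `w` satisfy the Dirichlet condition and vanish at late times, while only
`c⁻² ∂ₜ² w - Δ w` has to be of compact support in the open half-space. Those with `w` itself of
compact support give the wave equation; as `w` may extend to the infinite past, nothing but the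
waves emitted by `n` is present, which is the radiation condition. -/
structure IsCausalWaveField {Ω : Type*} [MeasurableSpace Ω] {P : Measure Ω} (c L : ℝ)
    (n : (ℝ × Space3 → ℝ) → Lp ℝ 2 P) (u : ℝ → Space3 → Lp ℝ 2 P) : Prop where
  continuousOn : ContinuousOn (fun p : ℝ × Space3 => u p.1 p.2) {p | 0 ≤ p.2 2 ∧ ‖p.2‖ ≠ L}
  locallyIntegrableOn :
    LocallyIntegrableOn (fun p : ℝ × Space3 => u p.1 p.2) {p | 0 < p.2 2} volume
  dirichlet : ∀ (t : ℝ) (x : Space3), x 2 = 0 → ‖x‖ ≠ L → u t x = 0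
  wave_equation : ∀ w : ℝ × Space3 → ℝ, ContDiff ℝ ∞ w → IsSourceTest L w →
    (∀ (s : ℝ) (y : Space3), y 2 = 0 → w (s, y) = 0) →
    (∃ S : ℝ, ∀ (s : ℝ) (y : Space3), S ≤ s → 0 ≤ y 2 → w (s, y) = 0) →
    (∃ C : Set (ℝ × Space3), IsCompact C ∧ C ⊆ {p | 0 < p.2 2} ∧
      ∀ p : ℝ × Space3, 0 < p.2 2 → p ∉ C → waveOp c w p = 0) →
    ∫ p in {p : ℝ × Space3 | 0 < p.2 2}, waveOp c w p • u p.1 p.2 = n w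

/-- Time coordinate of the Rindler observer at proper time `τ`. -/
def rindlerTime (c ξ τ : ℝ) : ℝ := ξ / c * Real.sinh (c * τ / ξ)

/-- Position of the Rindler observer at proper time `τ`:
`(0, 0, ξ₀) + ξ cosh(cτ/ξ) (sin α, 0, cos α)`. -/
def rindlerPos (c ξ α ξ₀ τ : ℝ) : Space3 :=
  !₂[0, 0, ξ₀] + (ξ * Real.cosh (c * τ / ξ)) • !₂[Real.sin α, 0, Real.cos α]

/-- The mirror image of the Rindler trajectory in the plane `z = 0`:
`(0, 0, -ξ₀) + ξ cosh(cτ/ξ) (sin α, 0, -cos α)`. -/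
def rindlerMirrorPos (c ξ α ξ₀ τ : ℝ) : Space3 :=
  !₂[0, 0, -ξ₀] + (ξ * Real.cosh (c * τ / ξ)) • !₂[Real.sin α, 0, -Real.cos α]

/-- The signal `U(τ) = u(T(τ), X(τ))` recorded by the Rindler observer. -/
def recordedSignal {Ω : Type*} [MeasurableSpace Ω] {P : Measure Ω}
    (u : ℝ → Space3 → Lp ℝ 2 P) (c ξ α ξ₀ τ : ℝ) : Lp ℝ 2 P :=
  u (rindlerTime c ξ τ) (rindlerPos c ξ α ξ₀ τ)

/-- The autocorrelation `⟨U(τ + τ'/2) U(τ - τ'/2)⟩` of a random signal `U`. -/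
def autocorrelation {Ω : Type*} [MeasurableSpace Ω] {P : Measure Ω}
    (U : ℝ → Lp ℝ 2 P) (τ τ' : ℝ) : ℝ :=
  ∫ a, U (τ + τ' / 2) a * U (τ - τ' / 2) a ∂P

/-- The frequency integral
`(8π²)⁻¹ ∫ F̂(k) sinc(k d / c) exp(i k t) dk` (`k` is the angular frequency). -/
def sincIntegral (Fhat : ℝ → ℝ) (c d t : ℝ) : ℂ :=
  1 / (8 * (Real.pi : ℂ) ^ 2) *
    ∫ k : ℝ, (Fhat k : ℂ) * (Real.sinc (k / c * d) : ℂ) * Complex.exp (Complex.I * k * t)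

end

/-! The field at a point is recovered from the source by duality. For `x` in the open half-space,
take as test function in the weak wave equation a short spherical pulse converging to `x` at time
`t`, cut off near `x`, minus its image in the plane `z = 0`. This function vanishes on the plane and
at late times. In the half-space its image under the wave operator is a kernel of mass one,
concentrated at scale `ε` around `(t, x)`. Mean-square continuity of the field then gives `u t x` as
the limit of `n (probeWave c ε t x)` (`tendsto_source_probeWave`).

The covariance of the field is therefore a limit of covariances of the source. As the pulses shrink,
it becomes a sum of four integrals over the half-sphere, with signs `+ - - +`, of `F(t - t' + (|y -
x'| - |y - x|)/c) / (16π² |y - x| |y - x'|)`, in which `x` and `x'` may each be replaced by their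
mirror images (`integral_field_mul_field`).

For large `L` and `y = Lθ`, the path difference tends to `θ · (x - x')`, and the area factor `L²`
compensates the decay of the two amplitudes. Each half-sphere integral has a limit
(`tendsto_integral_sourceCovariance`). Reflection pairs the two `+` terms into an integral over the
full sphere, and likewise the two `-` terms. Archimedes' hat-box theorem turns each full-sphere
integral into an average over `v ∈ [-1, 1]` (`integral_upper_add_mirror`). The frequency form
follows by Fubini from `∫_{-1}^{1} exp(ivr) dv = 2 sinc r` (`sincIntegral_eq`).

Of the trajectory itself, the argument needs only that it stays in `z > 0`, and that its mirror
curve is its reflection. -/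

noncomputable section

/-! ### Integration over the sphere and Archimedes' hat-box theorem -/

/-- Integration over the unit sphere as integration over the unit ball of a function that is
homogeneous of degree zero. -/
theorem integral_toSphere_eq_integral_ball {E : Type*} [NormedAddCommGroup E] [NormedSpace ℝ E]
    [MeasurableSpace E] [BorelSpace E] [FiniteDimensional ℝ E] [Nontrivial E]
    (μ : Measure E) [μ.IsAddHaarMeasure] (H : E → ℝ) :
    ∫ θ : sphere (0 : E) 1, H θ ∂μ.toSphere =
      Module.finrank ℝ E * ∫ y in ball (0 : E) 1, H (‖y‖⁻¹ • y) ∂μ := by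
  have hpos : 0 < Module.finrank ℝ E := Module.finrank_pos
  have h1 : ∫ y in ball (0 : E) 1, H (‖y‖⁻¹ • y) ∂μ =
      ∫ x : ({(0)}ᶜ : Set E), (ball (0 : E) 1).indicator (fun y => H (‖y‖⁻¹ • y)) x.1
        ∂(μ.comap (↑)) := by
    rw [integral_subtype_comap (measurableSet_singleton _).compl, restrict_compl_singleton,
      integral_indicator measurableSet_ball]
  -- In polar coordinates the integrand is a product. Its radial factor, the indicator of `r < 1`,
  -- has mass `1/n` for `r^(n-1) dr`, where `n` is the dimension.
  have h2 := μ.measurePreserving_homeomorphUnitSphereProd.integral_comp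
    (Homeomorph.measurableEmbedding _)
    (fun p => H p.1 * (Set.Iio (⟨1, Set.mem_Ioi.2 one_pos⟩ : Set.Ioi (0 : ℝ))).indicator
      (fun _ => (1 : ℝ)) p.2)
  rw [integral_prod_mul (fun θ : sphere (0 : E) 1 => H θ),
    integral_indicator_const _ measurableSet_Iio,
    Measure.real, Measure.volumeIoiPow_apply_Iio] at h2
  have h3 : ∀ x : ({(0)}ᶜ : Set E),
      (ball (0 : E) 1).indicator (fun y => H (‖y‖⁻¹ • y)) x.1 =
      H (homeomorphUnitSphereProd E x).1 *
        (Set.Iio (⟨1, Set.mem_Ioi.2 one_pos⟩ : Set.Ioi (0 : ℝ))).indicator (fun _ => (1 : ℝ))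
          (homeomorphUnitSphereProd E x).2 := by
    intro x
    have : (homeomorphUnitSphereProd E x).2 ∈
        Set.Iio (⟨1, Set.mem_Ioi.2 one_pos⟩ : Set.Ioi (0 : ℝ)) ↔
        x.1 ∈ ball (0 : E) 1 := by
      rw [Set.mem_Iio, ← Subtype.coe_lt_coe, homeomorphUnitSphereProd_apply_snd_coe,
        mem_ball_zero_iff]
    by_cases hx : x.1 ∈ ball (0 : E) 1
    · rw [Set.indicator_of_mem hx, Set.indicator_of_mem (this.2 hx), mul_one,
        homeomorphUnitSphereProd_apply_fst_coe]
    · rw [Set.indicator_of_notMem hx, Set.indicator_of_notMem (fun h => hx (this.1 h)), mul_zero]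
  rw [h1, integral_congr_ae (Eventually.of_forall h3), h2, Nat.cast_pred hpos]
  have : (Module.finrank ℝ E : ℝ) ≠ 0 := by positivity
  rw [ENNReal.toReal_ofReal (by simp)]
  simp
  field_simp

theorem integrable_of_bounded_of_support {X : Type*} [PseudoMetricSpace X] [ProperSpace X]
    [MeasurableSpace X] [BorelSpace X] {μ : Measure X} [IsFiniteMeasureOnCompacts μ]
    {f : X → ℝ} (hf : AEStronglyMeasurable f μ) {C : ℝ} (hC : ∀ x, ‖f x‖ ≤ C) {x₀ : X} {R : ℝ}
    (hR : ∀ x, x ∉ closedBall x₀ R → f x = 0) : Integrable f μ := by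
  have : IntegrableOn f (closedBall x₀ R) μ :=
    Measure.integrableOn_of_bounded (M := C) measure_closedBall_lt_top.ne hf
      (Eventually.of_forall hC)
  rwa [integrableOn_iff_integrable_of_support_subset] at this
  intro x hx
  by_contra h
  exact hx (hR x h)

theorem norm_sq_space3 (y : Space3) : ‖y‖ ^ 2 = y 0 ^ 2 + y 1 ^ 2 + y 2 ^ 2 := by
  simp [EuclideanSpace.norm_sq_eq, Fin.sum_univ_three]

/-- Integration in `ℝ³` of a function with axial symmetry. -/
theorem integral_cylindrical (Φ : ℝ → ℝ → ℝ)
    (hΦ : Integrable (fun q : ℝ × (Fin 2 → ℝ) => Φ q.1 (√(q.2 0 ^ 2 + q.2 1 ^ 2)))) :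
    ∫ y : Space3, Φ (y 2) (√(y 0 ^ 2 + y 1 ^ 2)) =
      2 * Real.pi * ∫ z, ∫ ρ in Set.Ioi (0 : ℝ), ρ * Φ z ρ := by
  have e1 := ((volume_preserving_piFinSuccAbove (fun _ : Fin 3 => ℝ) 2).comp
    (PiLp.volume_preserving_ofLp (Fin 3))).integral_comp'
    (f := (MeasurableEquiv.toLp 2 (Fin 3 → ℝ)).symm.trans
      (MeasurableEquiv.piFinSuccAbove (fun _ : Fin 3 => ℝ) 2))
    (fun q : ℝ × (Fin 2 → ℝ) => Φ q.1 (√(q.2 0 ^ 2 + q.2 1 ^ 2)))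
  have e2 : ∀ z : ℝ, ∫ p : Fin 2 → ℝ, Φ z (√(p 0 ^ 2 + p 1 ^ 2)) =
      2 * Real.pi * ∫ ρ in Set.Ioi (0 : ℝ), ρ * Φ z ρ := by
    intro z
    have e3 := (PiLp.volume_preserving_ofLp (Fin 2)).integral_comp'
      (f := (MeasurableEquiv.toLp 2 (Fin 2 → ℝ)).symm)
      (fun p : Fin 2 → ℝ => Φ z (√(p 0 ^ 2 + p 1 ^ 2)))
    rw [← e3]
    -- The factor `2π` arises as the dimension 2 times the area `π` of the unit disc.
    have e4 := integral_fun_norm_addHaar (volume : Measure (EuclideanSpace ℝ (Fin 2)))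
      (fun ρ => Φ z ρ)
    have e5 : ∀ p : EuclideanSpace ℝ (Fin 2), ‖p‖ = √(p 0 ^ 2 + p 1 ^ 2) := by
      intro p
      simp [EuclideanSpace.norm_eq, Fin.sum_univ_two]
    simp only [e5] at e4
    have e6 : (volume : Measure (EuclideanSpace ℝ (Fin 2))).real (ball 0 1) = Real.pi := by
      rw [Measure.real, EuclideanSpace.volume_ball_fin_two]
      simp [Real.pi_pos.le]
    rw [e6] at e4
    refine Eq.trans ?_ (e4.trans ?_)
    · rfl
    · simp [mul_assoc]
  calc _ = ∫ q : ℝ × (Fin 2 → ℝ), Φ q.1 (√(q.2 0 ^ 2 + q.2 1 ^ 2)) := by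
        rw [← e1]; rfl
    _ = _ := by
        rw [Measure.volume_eq_prod, integral_prod _ (by rwa [← Measure.volume_eq_prod])]
        simp only [e2]
        rw [integral_const_mul]

/-- Integration in the upper half-plane of polar coordinates. -/
theorem integral_halfPlane_ball (f : ℝ → ℝ) (hf : Continuous f) {C : ℝ} (hC : ∀ v, |f v| ≤ C) :
    ∫ z, ∫ ρ in Set.Ioi (0 : ℝ), ρ * (if z ^ 2 + ρ ^ 2 < 1 then f (z / √(z ^ 2 + ρ ^ 2)) else 0) =
      1 / 3 * ∫ v in (-1 : ℝ)..1, f v := by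
  set Ψ : ℝ × ℝ → ℝ := fun p => if 0 < p.2 ∧ p.1 ^ 2 + p.2 ^ 2 < 1 then
    p.2 * f (p.1 / √(p.1 ^ 2 + p.2 ^ 2)) else 0 with hΨ
  have hC0 : 0 ≤ C := (abs_nonneg _).trans (hC 0)
  have hmeas : Measurable Ψ := by
    refine Measurable.ite ?_ ?_ measurable_const
    · exact (measurableSet_lt measurable_const measurable_snd).inter
        (measurableSet_lt (f := fun p : ℝ × ℝ => p.1 ^ 2 + p.2 ^ 2) (by fun_prop)
          measurable_const)
    · have := hf.measurable
      fun_prop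
  have hint : Integrable Ψ := by
    refine integrable_of_bounded_of_support (C := C) hmeas.aestronglyMeasurable ?_
      (x₀ := 0) (R := 1) ?_
    · intro p
      simp only [hΨ]
      split_ifs with h
      · rw [norm_mul, Real.norm_eq_abs, Real.norm_eq_abs, abs_of_pos h.1]
        have h1 : p.2 ≤ 1 := by nlinarith [h.1, h.2, sq_nonneg p.1]
        nlinarith [hC (p.1 / √(p.1 ^ 2 + p.2 ^ 2)), abs_nonneg (f (p.1 / √(p.1 ^ 2 + p.2 ^ 2))),
          h.1]
      · simpa using hC0
    · intro p hp
      simp only [hΨ]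
      rw [if_neg]
      rintro ⟨h1, h2⟩
      apply hp
      rw [mem_closedBall_zero_iff, Prod.norm_def, Real.norm_eq_abs, Real.norm_eq_abs]
      exact max_le (abs_le.2 ⟨by nlinarith [sq_nonneg p.2], by nlinarith [sq_nonneg p.2]⟩)
        (abs_le.2 ⟨by nlinarith [sq_nonneg p.1], by nlinarith [sq_nonneg p.1]⟩)
  have e1 : ∀ z : ℝ, ∫ ρ in Set.Ioi (0 : ℝ), ρ * (if z ^ 2 + ρ ^ 2 < 1 then
      f (z / √(z ^ 2 + ρ ^ 2)) else 0) = ∫ ρ, Ψ (z, ρ) := by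
    intro z
    rw [← integral_indicator measurableSet_Ioi]
    refine integral_congr_ae (Eventually.of_forall fun ρ => ?_)
    simp only [Set.indicator, Set.mem_Ioi, hΨ]
    split_ifs <;> simp_all
  simp only [e1]
  rw [← integral_prod _ (by rwa [← Measure.volume_eq_prod]), ← Measure.volume_eq_prod,
    ← integral_comp_polarCoord_symm]
  -- With `z = r cos φ` and `ρ = r sin φ`, the condition `ρ > 0` leaves the angles in `(0, π)`. The
  -- weight `r²` comes from the Jacobian `r` and the factor `ρ`; its integral gives `1/3`.
  have e2 : ∫ p in polarCoord.target, p.1 • Ψ (polarCoord.symm p) =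
      ∫ p in Set.Ioo (0 : ℝ) 1 ×ˢ Set.Ioo (0 : ℝ) Real.pi,
        p.1 ^ 2 * (Real.sin p.2 * f (Real.cos p.2)) := by
    rw [← integral_indicator polarCoord.open_target.measurableSet,
      ← integral_indicator (measurableSet_Ioo.prod measurableSet_Ioo)]
    refine integral_congr_ae (Eventually.of_forall fun p => ?_)
    obtain ⟨r, φ⟩ := p
    simp only [Set.indicator, polarCoord_target, Set.mem_prod, Set.mem_Ioi, Set.mem_Ioo, hΨ,
      polarCoord_symm_apply]
    by_cases hr : 0 < r
    swap
    · simp [hr]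
    have hsq : (r * Real.cos φ) ^ 2 + (r * Real.sin φ) ^ 2 = r ^ 2 := by
      nlinarith [Real.sin_sq_add_cos_sq φ]
    rw [hsq, Real.sqrt_sq hr.le, mul_div_cancel_left₀ _ hr.ne']
    have h1 : r ^ 2 < 1 ↔ r < 1 := by rw [sq_lt_one_iff₀ hr.le]
    simp only [h1]
    by_cases hφ : -Real.pi < φ ∧ φ < Real.pi
    swap
    · rw [if_neg (by tauto), if_neg]
      rintro ⟨_, h2, h3⟩
      exact hφ ⟨by linarith [Real.pi_pos], h3⟩
    rw [if_pos ⟨hr, hφ⟩]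
    by_cases h0 : 0 < φ
    · have := Real.sin_pos_of_pos_of_lt_pi h0 hφ.2
      by_cases hr1 : r < 1
      · rw [if_pos ⟨by positivity, hr1⟩, if_pos ⟨⟨hr, hr1⟩, h0, hφ.2⟩, smul_eq_mul]
        ring
      · rw [if_neg (by tauto), if_neg (by tauto), smul_zero]
    · have := Real.sin_nonpos_of_nonpos_of_neg_pi_le (not_lt.1 h0) hφ.1.le
      rw [if_neg, if_neg (by tauto), smul_zero]
      rintro ⟨h2, _⟩
      nlinarith
  rw [e2, Measure.volume_eq_prod, setIntegral_prod_mul (fun r : ℝ => r ^ 2)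
      (fun φ => Real.sin φ * f (Real.cos φ)),
    ← integral_Ioc_eq_integral_Ioo, ← integral_Ioc_eq_integral_Ioo,
    ← intervalIntegral.integral_of_le zero_le_one,
    ← intervalIntegral.integral_of_le Real.pi_pos.le, integral_pow]
  have e3 := intervalIntegral.integral_comp_mul_deriv (a := 0) (b := Real.pi)
    (f := Real.cos) (f' := fun x => -Real.sin x) (g := f)
    (fun x _ => Real.hasDerivAt_cos x) (by fun_prop) hf
  rw [Real.cos_zero, Real.cos_pi] at e3
  rw [intervalIntegral.integral_symm 1 (-1), ← e3, ← intervalIntegral.integral_neg]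
  norm_num
  refine intervalIntegral.integral_congr fun x _ => ?_
  simp [mul_comm]

/-- The hat-box theorem for the third coordinate axis: the quotient is the cosine of the polar
angle, so cylindrical coordinates about the axis reduce the integral to the half-plane `ρ > 0`. -/
theorem integral_ball_axis (f : ℝ → ℝ) (hf : Continuous f) {C : ℝ} (hC : ∀ v, |f v| ≤ C) :
    ∫ y in ball (0 : Space3) 1, f (y 2 / ‖y‖) =
      2 * Real.pi / 3 * ∫ v in (-1 : ℝ)..1, f v := by
  have hC0 : 0 ≤ C := (abs_nonneg _).trans (hC 0)
  set Φ : ℝ → ℝ → ℝ := fun z ρ => if z ^ 2 + ρ ^ 2 < 1 then f (z / √(z ^ 2 + ρ ^ 2)) else 0 with hΦ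
  have hsq : ∀ p : Fin 2 → ℝ, √(p 0 ^ 2 + p 1 ^ 2) ^ 2 = p 0 ^ 2 + p 1 ^ 2 :=
    fun p => Real.sq_sqrt (by positivity)
  have hint : Integrable (fun q : ℝ × (Fin 2 → ℝ) => Φ q.1 (√(q.2 0 ^ 2 + q.2 1 ^ 2))) := by
    refine integrable_of_bounded_of_support (C := C) ?_ ?_ (x₀ := 0) (R := 1) ?_
    · refine Measurable.aestronglyMeasurable (Measurable.ite ?_ ?_ measurable_const)
      · exact measurableSet_lt (by fun_prop) measurable_const
      · have := hf.measurable
        fun_prop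
    · intro q
      simp only [hΦ]
      split_ifs
      · exact hC _
      · simpa using hC0
    · rintro ⟨z, p⟩ hp
      simp only [hΦ, hsq]
      rw [if_neg]
      intro h
      apply hp
      rw [mem_closedBall_zero_iff, Prod.norm_def]
      refine max_le (abs_le.2 ?_) ((pi_norm_le_iff_of_nonneg zero_le_one).2 fun i => abs_le.2 ?_)
      · constructor <;> nlinarith [sq_nonneg (p 0), sq_nonneg (p 1)]
      · fin_cases i <;> simp only [Fin.zero_eta, Fin.mk_one, Fin.isValue] <;> constructor <;>
          nlinarith [sq_nonneg (p 0), sq_nonneg (p 1), sq_nonneg z]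
  have e1 := integral_cylindrical Φ hint
  rw [integral_halfPlane_ball f hf hC] at e1
  rw [← integral_indicator measurableSet_ball]
  refine Eq.trans (integral_congr_ae (Eventually.of_forall fun y => ?_)) (e1.trans (by ring))
  have h1 : y 2 ^ 2 + √(y 0 ^ 2 + y 1 ^ 2) ^ 2 = ‖y‖ ^ 2 := by
    rw [norm_sq_space3, Real.sq_sqrt (by positivity)]; ring
  simp only [Set.indicator, mem_ball_zero_iff, hΦ, h1, Real.sqrt_sq (norm_nonneg y),
    sq_lt_one_iff₀ (norm_nonneg y)]

/-- Archimedes' hat-box theorem: on the unit sphere of `ℝ³`, the projection to an axis is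
uniformly distributed. -/
theorem integral_ball_inner (f : ℝ → ℝ) (hf : Continuous f) {C : ℝ} (hC : ∀ v, |f v| ≤ C)
    (b : Space3) :
    ∫ y in ball (0 : Space3) 1, f (inner ℝ (‖y‖⁻¹ • y) b) =
      2 * Real.pi / 3 * ∫ v in (-1 : ℝ)..1, f (v * ‖b‖) := by
  set e : Space3 := EuclideanSpace.single 2 ‖b‖ with he
  have hb : ‖b‖ = ‖e‖ := by simp [he]
  -- Since `b` and `e` have equal norms, the reflection across the orthogonal complement of `b - e`
  -- maps `b` to `e`. This reduces a general direction to the axis.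
  set R := (Submodule.span ℝ {b - e})ᗮ.reflection with hR
  have hRb : R b = e := Submodule.reflection_sub hb
  have e1 := (R.measurePreserving (F := Space3)).setIntegral_preimage_emb
    R.toHomeomorph.measurableEmbedding
    (fun y => f (inner ℝ (‖y‖⁻¹ • y) e)) (ball 0 1)
  have e2 : R ⁻¹' ball 0 1 = ball 0 1 := by
    ext y; simp
  rw [e2] at e1
  have e3 : ∀ y, f (inner ℝ (‖R y‖⁻¹ • R y) e) = f (inner ℝ (‖y‖⁻¹ • y) b) := by
    intro y
    rw [← hRb, LinearIsometryEquiv.norm_map, ← map_smul, LinearIsometryEquiv.inner_map_map]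
  simp only [e3] at e1
  rw [e1, ← integral_ball_axis (fun v => f (v * ‖b‖)) (by fun_prop) (fun v => hC _)]
  refine integral_congr_ae (Eventually.of_forall fun y => ?_)
  simp only
  congr 1
  simp [he, inner_smul_left, EuclideanSpace.inner_single_right]
  ring

/-! ### Mirror reflection and half-sphere integrals -/

/-- The reflection in the plane `z = 0`. -/
def mirror : Space3 ≃ₗᵢ[ℝ] Space3 :=
  LinearIsometryEquiv.piLpCongrRight 2
    (fun i : Fin 3 => if i = 2 then LinearIsometryEquiv.neg ℝ else LinearIsometryEquiv.refl ℝ ℝ)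

@[simp] theorem mirror_apply_zero (x : Space3) : mirror x 0 = x 0 := by simp [mirror]

@[simp] theorem mirror_apply_one (x : Space3) : mirror x 1 = x 1 := by simp [mirror]

@[simp] theorem mirror_apply_two (x : Space3) : mirror x 2 = -x 2 := by simp [mirror]

@[simp] theorem mirror_mirror (x : Space3) : mirror (mirror x) = x := by
  ext i
  fin_cases i <;> simp

theorem mirror_of_apply_two_eq_zero {y : Space3} (hy : y 2 = 0) : mirror y = y := by
  ext i
  fin_cases i <;> simp [hy]

theorem inner_mirror_left (x y : Space3) : inner ℝ (mirror x) y = inner ℝ x (mirror y) := by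
  rw [← LinearIsometryEquiv.inner_map_map mirror x (mirror y), mirror_mirror]

theorem measurableSet_upper : MeasurableSet {y : Space3 | 0 < y 2} :=
  measurableSet_lt measurable_const (by fun_prop)

theorem volume_plane : volume {y : Space3 | y 2 = 0} = 0 := by
  have h := Measure.addHaar_submodule (volume : Measure Space3)
    (LinearMap.ker (EuclideanSpace.proj (𝕜 := ℝ) (2 : Fin 3) : Space3 →L[ℝ] ℝ).toLinearMap) (by
      intro h
      have h1 : EuclideanSpace.single (2 : Fin 3) (1 : ℝ) ∈
          LinearMap.ker (EuclideanSpace.proj (𝕜 := ℝ) (2 : Fin 3) : Space3 →L[ℝ] ℝ).toLinearMap := by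
        rw [h]; trivial
      simp at h1)
  convert h using 2
  ext y
  simp

/-- The reflection preserves volume and carries the upper half of `S` to its lower half; the plane
between them is a null set. -/
theorem setIntegral_upper_add_comp_mirror {S : Set Space3} (hS : mirror ⁻¹' S = S)
    (hSm : MeasurableSet S) {G : Space3 → ℝ} (hG : IntegrableOn G S) :
    (∫ y in S ∩ {y | 0 < y 2}, G y) + (∫ y in S ∩ {y | 0 < y 2}, G (mirror y)) =
      ∫ y in S, G y := by
  have e1 := (mirror.measurePreserving (F := Space3)).setIntegral_preimage_emb
    mirror.toHomeomorph.measurableEmbedding G (S ∩ {y | y 2 < 0})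
  have e2 : mirror ⁻¹' (S ∩ {y | y 2 < 0}) = S ∩ {y | 0 < y 2} := by
    rw [Set.preimage_inter, hS]
    ext y; simp
  rw [e2] at e1
  have hlow : MeasurableSet {y : Space3 | y 2 < 0} :=
    measurableSet_lt (by fun_prop) measurable_const
  rw [e1, ← setIntegral_union _ (hSm.inter hlow) (hG.mono_set Set.inter_subset_left)
    (hG.mono_set Set.inter_subset_left)]
  · refine setIntegral_congr_set ?_
    have h0 : ∀ᵐ y : Space3, y 2 ≠ 0 := by
      rw [ae_iff]; simpa using volume_plane
    filter_upwards [h0] with y hy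
    refine propext ⟨?_, fun h => ?_⟩
    · rintro (h | h)
      exacts [h.1, h.1]
    · rcases lt_or_gt_of_ne hy with h1 | h1
      exacts [Or.inr ⟨h, h1⟩, Or.inl ⟨h, h1⟩]
  · rw [Set.disjoint_left]
    rintro y ⟨_, h1⟩ ⟨_, h2⟩
    simp only [Set.mem_ofPred_eq] at h1 h2
    exact lt_asymm h1 h2

theorem setIntegral_toSphere_upper (H : Space3 → ℝ) :
    ∫ θ : sphere (0 : Space3) 1 in {θ | 0 < (θ : Space3) 2}, H θ ∂(volume : Measure Space3).toSphere =
      3 * ∫ y in ball (0 : Space3) 1 ∩ {y | 0 < y 2}, H (‖y‖⁻¹ • y) := by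
  have hm : MeasurableSet {θ : sphere (0 : Space3) 1 | 0 < (θ : Space3) 2} :=
    measurable_subtype_coe measurableSet_upper
  rw [← integral_indicator hm]
  have h := integral_toSphere_eq_integral_ball (volume : Measure Space3)
    ({y : Space3 | 0 < y 2}.indicator H)
  rw [finrank_euclideanSpace, Fintype.card_fin] at h
  refine Eq.trans ?_ (h.trans ?_)
  · rfl
  · rw [← setIntegral_indicator measurableSet_upper, Nat.cast_ofNat]
    congr 2
    ext y
    have : ‖y‖⁻¹ • y ∈ {y : Space3 | 0 < y 2} ↔ y ∈ {y : Space3 | 0 < y 2} := by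
      simp only [Set.mem_ofPred_eq, PiLp.smul_apply, smul_eq_mul]
      refine ⟨fun h => pos_of_mul_pos_right h (by positivity), fun h => mul_pos ?_ h⟩
      rw [inv_pos, norm_pos_iff]
      rintro rfl
      simp at h
    by_cases hy : y ∈ {y : Space3 | 0 < y 2}
    · rw [Set.indicator_of_mem hy, Set.indicator_of_mem (this.2 hy)]
    · rw [Set.indicator_of_notMem hy, Set.indicator_of_notMem (fun h => hy (this.1 h))]

/-- The two halves of the hat-box theorem, combined by reflection in the plane `z = 0`. -/
theorem integral_upper_add_mirror (f : ℝ → ℝ) (hf : Continuous f) {C : ℝ} (hC : ∀ v, |f v| ≤ C)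
    (b : Space3) :
    (∫ θ : sphere (0 : Space3) 1 in {θ | 0 < (θ : Space3) 2}, f (inner ℝ (θ : Space3) b)
        ∂(volume : Measure Space3).toSphere) +
      (∫ θ : sphere (0 : Space3) 1 in {θ | 0 < (θ : Space3) 2}, f (inner ℝ (θ : Space3) (mirror b))
        ∂(volume : Measure Space3).toSphere) =
      2 * Real.pi * ∫ v in (-1 : ℝ)..1, f (v * ‖b‖) := by
  rw [setIntegral_toSphere_upper (fun y => f (inner ℝ y b)),
    setIntegral_toSphere_upper (fun y => f (inner ℝ y (mirror b))), ← mul_add]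
  have h1 : mirror ⁻¹' ball 0 1 = ball 0 1 := by ext y; simp
  have h2 := setIntegral_upper_add_comp_mirror h1 measurableSet_ball
    (G := fun y => f (inner ℝ (‖y‖⁻¹ • y) b))
    (Measure.integrableOn_of_bounded (M := C) measure_ball_lt_top.ne
      (Measurable.aestronglyMeasurable (by have := hf.measurable; fun_prop))
      (Eventually.of_forall fun y => hC _))
  simp only [LinearIsometryEquiv.norm_map, ← map_smul, inner_mirror_left] at h2
  rw [h2, integral_ball_inner f hf hC]
  ring

/-! ### The surface measure of the half-sphere and the far-field limit -/

theorem measurableEmbedding_smul_sphere {L : ℝ} (hL : 0 < L) :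
    MeasurableEmbedding (fun y : sphere (0 : Space3) 1 => L • (y : Space3)) :=
  (MeasurableEquiv.smul₀ L hL.ne').measurableEmbedding.comp
    (MeasurableEmbedding.subtype_coe isClosed_sphere.measurableSet)

theorem integral_hemisphereMeasure {L : ℝ} (hL : 0 < L) (G : Space3 → ℝ) :
    ∫ y, G y ∂(hemisphereMeasure L) =
      L ^ 2 * ∫ θ : sphere (0 : Space3) 1 in {θ | 0 < (θ : Space3) 2}, G (L • (θ : Space3))
        ∂(volume : Measure Space3).toSphere := by
  rw [hemisphereMeasure, Measure.restrict_smul, integral_smul_measure,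
    (measurableEmbedding_smul_sphere hL).setIntegral_map, ENNReal.toReal_ofReal (by positivity),
    smul_eq_mul]
  congr 3
  ext θ
  simp [hL]

theorem hemisphereMeasure_univ_lt_top {L : ℝ} (hL : 0 < L) :
    hemisphereMeasure L Set.univ < ⊤ := by
  rw [hemisphereMeasure, Measure.restrict_apply_univ, Measure.smul_apply, smul_eq_mul,
    (measurableEmbedding_smul_sphere hL).map_apply]
  exact ENNReal.mul_lt_top ENNReal.ofReal_lt_top (measure_lt_top _ _)

theorem ae_hemisphereMeasure {L : ℝ} (hL : 0 < L) :
    ∀ᵐ y ∂(hemisphereMeasure L), ‖y‖ = L ∧ 0 < y 2 := by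
  have h1 : ∀ᵐ y ∂(hemisphereMeasure L), 0 < y 2 := ae_restrict_mem measurableSet_upper
  have h2 : ∀ᵐ y ∂(hemisphereMeasure L), ‖y‖ = L := by
    refine ae_restrict_of_ae (Measure.ae_smul_measure ?_ _)
    rw [(measurableEmbedding_smul_sphere hL).ae_map_iff]
    refine Eventually.of_forall fun θ => ?_
    simp [norm_smul, abs_of_pos hL]
  filter_upwards [h1, h2] with y a b using ⟨b, a⟩

/-- Far-field expansion of the distance to a point. -/
theorem tendsto_norm_smul_sub_sub (θ x : Space3) (hθ : ‖θ‖ = 1) :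
    Tendsto (fun L : ℝ => ‖L • θ - x‖ - L) atTop (𝓝 (-inner ℝ θ x)) := by
  have hr : Tendsto (fun L : ℝ => ‖θ - L⁻¹ • x‖) atTop (𝓝 1) := by
    have : Tendsto (fun L : ℝ => ‖θ - L⁻¹ • x‖) atTop (𝓝 ‖θ - (0 : ℝ) • x‖) :=
      ((tendsto_inv_atTop_zero.smul_const x).const_sub θ).norm
    simpa [hθ] using this
  -- This is the difference of norms after rationalization, `(‖Lθ - x‖² - L²) / (‖Lθ - x‖ + L)`,
  -- with numerator and denominator divided by `L`.
  have h1 : Tendsto (fun L : ℝ => (‖x‖ ^ 2 * L⁻¹ - 2 * inner ℝ θ x) / (‖θ - L⁻¹ • x‖ + 1)) atTop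
      (𝓝 ((‖x‖ ^ 2 * 0 - 2 * inner ℝ θ x) / (1 + 1))) :=
    ((tendsto_inv_atTop_zero.const_mul _).sub_const _).div (hr.add_const 1) (by norm_num)
  have h2 : (‖x‖ ^ 2 * 0 - 2 * inner ℝ θ x) / (1 + 1) = -inner ℝ θ x := by ring
  rw [h2] at h1
  refine h1.congr' ?_
  filter_upwards [eventually_gt_atTop 0] with L hL
  have e1 : ‖θ - L⁻¹ • x‖ = ‖L • θ - x‖ / L := by
    rw [eq_div_iff hL.ne', mul_comm]
    nth_rw 1 [← abs_of_pos hL]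
    rw [← Real.norm_eq_abs, ← norm_smul, smul_sub, smul_smul, mul_inv_cancel₀ hL.ne', one_smul]
  have e2 : ‖L • θ - x‖ ^ 2 = L ^ 2 - 2 * (L * inner ℝ θ x) + ‖x‖ ^ 2 := by
    rw [norm_sub_sq_real, norm_smul, hθ, inner_smul_left, mul_one, Real.norm_eq_abs, sq_abs]
    rfl
  have e3 : 0 < ‖L • θ - x‖ + L := by positivity
  rw [e1]
  have e4 : ‖L • θ - x‖ / L + 1 = (‖L • θ - x‖ + L) / L := by field_simp
  rw [e4, div_div_eq_mul_div, div_eq_iff e3.ne']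
  field_simp
  nlinarith

/-- Covariance of the spherical waves received at `x` and `x'` from a source at `y`. -/
def sourceCovariance (f : ℝ → ℝ) (x x' y : Space3) : ℝ :=
  f (‖y - x'‖ - ‖y - x‖) / (16 * Real.pi ^ 2 * (‖y - x‖ * ‖y - x'‖))

/-- On the unit sphere the integrand acquires the area factor `L²`, which balances the product of
two distances, each asymptotic to `L`. Dominated convergence then applies. -/
theorem tendsto_integral_sourceCovariance (f : ℝ → ℝ) (hf : Continuous f) {C : ℝ}
    (hC : ∀ v, |f v| ≤ C) (x x' : Space3) :
    Tendsto (fun L => ∫ y, sourceCovariance f x x' y ∂(hemisphereMeasure L)) atTop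
      (𝓝 (1 / (16 * Real.pi ^ 2) *
        ∫ θ : sphere (0 : Space3) 1 in {θ | 0 < (θ : Space3) 2}, f (inner ℝ (θ : Space3) (x - x'))
        ∂(volume : Measure Space3).toSphere)) := by
  have hC0 : 0 ≤ C := (abs_nonneg _).trans (hC 0)
  rw [← integral_const_mul]
  have hmain : Tendsto (fun L : ℝ => ∫ θ : sphere (0 : Space3) 1 in {θ | 0 < (θ : Space3) 2},
      L ^ 2 * sourceCovariance f x x' (L • (θ : Space3)) ∂(volume : Measure Space3).toSphere) atTop
      (𝓝 (∫ θ : sphere (0 : Space3) 1 in {θ | 0 < (θ : Space3) 2},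
        1 / (16 * Real.pi ^ 2) * f (inner ℝ (θ : Space3) (x - x'))
        ∂(volume : Measure Space3).toSphere)) := by
    -- Once `L ≥ 2‖x‖` and `L ≥ 2‖x'‖`, both distances are at least `L/2`, whence the factor 4 in
    -- the bound.
    refine tendsto_integral_filter_of_dominated_convergence
      (fun _ => C / (16 * Real.pi ^ 2) * 4) ?_ ?_ (integrable_const _) ?_
    · refine Eventually.of_forall fun L => Measurable.aestronglyMeasurable ?_
      have := hf.measurable
      unfold sourceCovariance
      fun_prop
    · filter_upwards [eventually_gt_atTop 0, eventually_ge_atTop (2 * ‖x‖),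
        eventually_ge_atTop (2 * ‖x'‖)] with L hL h1 h2
      refine Eventually.of_forall fun θ => ?_
      have hn : ‖L • (θ : Space3)‖ = L := by simp [norm_smul, abs_of_pos hL]
      have a1 : L / 2 ≤ ‖L • (θ : Space3) - x‖ := by
        have := norm_sub_norm_le (L • (θ : Space3)) x
        linarith
      have a2 : L / 2 ≤ ‖L • (θ : Space3) - x'‖ := by
        have := norm_sub_norm_le (L • (θ : Space3)) x'
        linarith
      rw [sourceCovariance, norm_mul, norm_div, Real.norm_eq_abs, Real.norm_eq_abs, Real.norm_eq_abs,
        abs_of_nonneg (by positivity : 0 ≤ L ^ 2),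
        abs_of_nonneg (by positivity : 0 ≤ 16 * Real.pi ^ 2 *
          (‖L • (θ : Space3) - x‖ * ‖L • (θ : Space3) - x'‖))]
      have a3 : L ^ 2 / 4 ≤ ‖L • (θ : Space3) - x‖ * ‖L • (θ : Space3) - x'‖ := by
        have := mul_le_mul a1 a2 (by positivity) (norm_nonneg _)
        linarith
      calc _ ≤ L ^ 2 * (C / (16 * Real.pi ^ 2 * (L ^ 2 / 4))) := by
            gcongr
            exact hC _
        _ = _ := by field_simp
    · refine Eventually.of_forall fun θ => ?_
      have hθ : ‖(θ : Space3)‖ = 1 := by simp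
      have t1 := tendsto_norm_smul_sub_sub θ x hθ
      have t2 := tendsto_norm_smul_sub_sub θ x' hθ
      have t3 : Tendsto (fun L : ℝ => ‖L • (θ : Space3) - x'‖ - ‖L • (θ : Space3) - x‖) atTop
          (𝓝 (inner ℝ (θ : Space3) (x - x'))) := by
        have := t2.sub t1
        rw [inner_sub_right]
        convert this using 2 <;> ring
      have hr : ∀ z : Space3, Tendsto (fun L : ℝ => ‖L • (θ : Space3) - z‖ / L) atTop (𝓝 1) := by
        intro z
        have := ((tendsto_norm_smul_sub_sub θ z hθ).mul tendsto_inv_atTop_zero).add_const 1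
        rw [mul_zero, zero_add] at this
        refine this.congr' ?_
        filter_upwards [eventually_gt_atTop 0] with L hL
        field_simp
        ring
      have t4 := ((hf.tendsto _).comp t3).div
        (((hr x).mul (hr x')).const_mul (16 * Real.pi ^ 2)) (by positivity)
      have e : f (inner ℝ (θ : Space3) (x - x')) / (16 * Real.pi ^ 2 * (1 * 1)) =
        1 / (16 * Real.pi ^ 2) * f (inner ℝ (θ : Space3) (x - x')) := by ring
      rw [e] at t4
      refine t4.congr' ?_
      filter_upwards [eventually_gt_atTop 0] with L hL
      rw [Pi.div_apply, Function.comp_apply, sourceCovariance, div_mul_div_comm, mul_div_assoc',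
        div_div_eq_mul_div]
      ring
  refine hmain.congr' ?_
  filter_upwards [eventually_gt_atTop 0] with L hL
  rw [integral_hemisphereMeasure hL, integral_const_mul]

/-- Limit of the covariance of two image-corrected fields for sources on a large half-sphere. -/
theorem tendsto_integral_sourceCovariance_images (f : ℝ → ℝ) (hf : Continuous f) {C : ℝ}
    (hC : ∀ v, |f v| ≤ C) (x x' : Space3) :
    Tendsto (fun L => (∫ y, sourceCovariance f x x' y ∂(hemisphereMeasure L))
        - (∫ y, sourceCovariance f x (mirror x') y ∂(hemisphereMeasure L))
        - (∫ y, sourceCovariance f (mirror x) x' y ∂(hemisphereMeasure L))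
        + (∫ y, sourceCovariance f (mirror x) (mirror x') y ∂(hemisphereMeasure L))) atTop
      (𝓝 (1 / (8 * Real.pi) * (∫ v in (-1 : ℝ)..1, f (v * ‖x - x'‖))
        - 1 / (8 * Real.pi) * (∫ v in (-1 : ℝ)..1, f (v * ‖mirror x - x'‖)))) := by
  have h := (((tendsto_integral_sourceCovariance f hf hC x x').sub
    (tendsto_integral_sourceCovariance f hf hC x (mirror x'))).sub
    (tendsto_integral_sourceCovariance f hf hC (mirror x) x')).add
    (tendsto_integral_sourceCovariance f hf hC (mirror x) (mirror x'))
  -- The mirror image of `x - x'` is the difference of the two images, so `e1` pairs the terms with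
  -- sign `+`. The mirror image of `mirror x - x'` is `x - mirror x'`, so `e2` pairs the cross
  -- terms.
  have e1 := integral_upper_add_mirror f hf hC (x - x')
  have e2 := integral_upper_add_mirror f hf hC (mirror x - x')
  rw [map_sub] at e1 e2
  rw [mirror_mirror] at e2
  convert h using 2
  have hp := Real.pi_ne_zero
  have e3 : ∀ A : ℝ, 1 / (8 * Real.pi) * A = 1 / (16 * Real.pi ^ 2) * (2 * Real.pi * A) := by
    intro A; field_simp; ring
  rw [e3, e3, ← e1, ← e2]
  ring

/-! ### Spherical waves and the wave operator -/

theorem hasFDerivAt_radial {g : ℝ → ℝ} {g' : ℝ} {x z : Space3} (hz : z ≠ x)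
    (hg : HasDerivAt g g' ‖z - x‖) :
    HasFDerivAt (fun y => g ‖y - x‖) ((g' / ‖z - x‖) • innerSL ℝ (z - x)) z := by
  have hr : 0 < ‖z - x‖ := norm_pos_iff.2 (sub_ne_zero.2 hz)
  have h1 : HasFDerivAt (fun y : Space3 => ‖y - x‖ ^ 2) (2 • innerSL ℝ (z - x)) z :=
    ((hasFDerivAt_id z).sub_const x).norm_sq.congr_fderiv (by ext; simp)
  have h2 := h1.sqrt (by positivity)
  simp only [Real.sqrt_sq (norm_nonneg _)] at h2
  have h3 := hg.comp_hasFDerivAt z h2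
  refine h3.congr_fderiv ?_
  ext v
  simp
  field_simp

/-- The Laplacian of a radial function `G(r) / r` of three variables is `G''(r) / r`. -/
theorem laplacian_radial_div {G : ℝ → ℝ} (hG : ContDiff ℝ 2 G) {x z : Space3} (hz : z ≠ x) :
    Δ (fun y : Space3 => G ‖y - x‖ / ‖y - x‖) z = deriv (deriv G) ‖z - x‖ / ‖z - x‖ := by
  have hG1 : ∀ r, HasDerivAt G (deriv G r) r := fun r =>
    (hG.differentiable (by norm_num) r).hasDerivAt
  have hG' : ContDiff ℝ 1 (deriv G) :=
    (contDiff_succ_iff_deriv.1 (show ContDiff ℝ (1 + 1) G by exact_mod_cast hG)).2.2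
  have hG2 : ∀ r, HasDerivAt (deriv G) (deriv (deriv G) r) r := fun r =>
    (hG'.differentiable (by norm_num) r).hasDerivAt
  -- Here `m = (G/r)'/r`, so that the gradient of `G(r)/r` is `m(r) (y - x)`. The trace of its
  -- derivative is `3m + r m' = G''/r`.
  set m : ℝ → ℝ := fun r => (deriv G r * r - G r) / r ^ 3 with hm
  have hr : 0 < ‖z - x‖ := norm_pos_iff.2 (sub_ne_zero.2 hz)
  have h1 : ∀ y, y ≠ x → HasFDerivAt (fun y : Space3 => G ‖y - x‖ / ‖y - x‖)
      (m ‖y - x‖ • innerSL ℝ (y - x)) y := by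
    intro y hy
    have hr : 0 < ‖y - x‖ := norm_pos_iff.2 (sub_ne_zero.2 hy)
    refine (hasFDerivAt_radial hy ((hG1 _).div (hasDerivAt_id _) hr.ne')).congr_fderiv ?_
    congr 1
    simp only [hm, id_eq]
    field_simp
  have h2 : fderiv ℝ (fun y : Space3 => G ‖y - x‖ / ‖y - x‖) =ᶠ[𝓝 z]
      fun y => m ‖y - x‖ • innerSL ℝ (y - x) := by
    filter_upwards [isOpen_ne.mem_nhds hz] with y hy using (h1 y hy).fderiv
  have hm' : HasDerivAt m (deriv (deriv G) ‖z - x‖ / ‖z - x‖ ^ 2 - 3 * m ‖z - x‖ / ‖z - x‖)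
      ‖z - x‖ := by
    have := (((hG2 ‖z - x‖).mul (hasDerivAt_id _)).sub (hG1 ‖z - x‖)).div
      (hasDerivAt_pow 3 ‖z - x‖) (by positivity)
    refine this.congr_deriv ?_
    simp only [hm, id_eq]
    simp
    field_simp
  have h3 : HasFDerivAt (fun y => m ‖y - x‖ • innerSL ℝ (y - x)) _ z :=
    (hasFDerivAt_radial hz hm').smul
      ((innerSL ℝ (E := Space3)).hasFDerivAt.comp z ((hasFDerivAt_id z).sub_const x))
  have h4 : fderiv ℝ (fderiv ℝ (fun y : Space3 => G ‖y - x‖ / ‖y - x‖)) z = _ :=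
    h2.fderiv_eq.trans h3.fderiv
  have h5 : ∀ v : Space3, fderiv ℝ (fderiv ℝ (fun y : Space3 => G ‖y - x‖ / ‖y - x‖)) z v v =
      m ‖z - x‖ * inner ℝ v v + (deriv (deriv G) ‖z - x‖ / ‖z - x‖ ^ 2 - 3 * m ‖z - x‖ / ‖z - x‖) /
        ‖z - x‖ * inner ℝ (z - x) v * inner ℝ (z - x) v := by
    intro v
    rw [h4]
    simp only [add_apply, smul_apply,
      ContinuousLinearMap.comp_apply, ContinuousLinearMap.smulRight_apply, innerSL_apply_apply,
      smul_eq_mul, ContinuousLinearMap.id_apply]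
    rfl
  rw [InnerProductSpace.laplacian_eq_iteratedFDeriv_orthonormalBasis _
    (EuclideanSpace.basisFun (Fin 3) ℝ)]
  simp only [iteratedFDeriv_two_apply, Matrix.cons_val_zero, Matrix.cons_val_one, h5]
  have h6 := norm_sq_space3 (z - x)
  simp only [Fin.sum_univ_three, EuclideanSpace.basisFun_apply, EuclideanSpace.inner_single_right,
    PiLp.single_apply]
  have h7 : ∀ A B a b c R : ℝ, R ≠ 0 → R ^ 2 = a ^ 2 + b ^ 2 + c ^ 2 →
      A + (B / R ^ 2 - 3 * A / R) / R * a * a + (A + (B / R ^ 2 - 3 * A / R) / R * b * b) +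
        (A + (B / R ^ 2 - 3 * A / R) / R * c * c) = B / R := by
    intro A B a b c R hR h
    have : A + (B / R ^ 2 - 3 * A / R) / R * a * a + (A + (B / R ^ 2 - 3 * A / R) / R * b * b) +
        (A + (B / R ^ 2 - 3 * A / R) / R * c * c) =
        3 * A + (B / R ^ 2 - 3 * A / R) / R * (a ^ 2 + b ^ 2 + c ^ 2) := by ring
    rw [this, ← h]
    field_simp
    ring
  simpa using h7 (m ‖z - x‖) (deriv (deriv G) ‖z - x‖) _ _ _ _ hr.ne' h6

/-- The spherical wave `h(s + r/c) χ(r) / (4π r)`, `r = |y - x|`, converging to the point `x`.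
The cut-off `χ` removes the singularity at `x`. -/
def sphericalWave (c : ℝ) (h χ : ℝ → ℝ) (x : Space3) (p : ℝ × Space3) : ℝ :=
  h (p.1 + ‖p.2 - x‖ / c) * χ ‖p.2 - x‖ / (4 * Real.pi * ‖p.2 - x‖)

/-- The source of the spherical wave `sphericalWave`. -/
def sphericalSource (c : ℝ) (h χ : ℝ → ℝ) (x : Space3) (p : ℝ × Space3) : ℝ :=
  -(2 / c * deriv h (p.1 + ‖p.2 - x‖ / c) * deriv χ ‖p.2 - x‖ +
    h (p.1 + ‖p.2 - x‖ / c) * deriv (deriv χ) ‖p.2 - x‖) / (4 * Real.pi * ‖p.2 - x‖)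

section

variable {c a : ℝ} {h χ : ℝ → ℝ}

theorem sphericalWave_eventuallyEq_zero (ha : 0 < a) (hχ0 : ∀ r, r ≤ a → χ r = 0)
    (p : ℝ × Space3) : sphericalWave c h χ p.2 =ᶠ[𝓝 p] 0 := by
  have : ∀ᶠ q : ℝ × Space3 in 𝓝 p, ‖q.2 - p.2‖ < a := by
    have hc : Continuous fun q : ℝ × Space3 => ‖q.2 - p.2‖ := by fun_prop
    exact hc.continuousAt.eventually_lt continuousAt_const (by simpa using ha)
  filter_upwards [this] with q hq
  simp [sphericalWave, hχ0 _ hq.le]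

theorem contDiff_sphericalWave (hh : ContDiff ℝ ∞ h) (hχ : ContDiff ℝ ∞ χ) (ha : 0 < a)
    (hχ0 : ∀ r, r ≤ a → χ r = 0) (x : Space3) : ContDiff ℝ ∞ (sphericalWave c h χ x) := by
  rw [contDiff_iff_contDiffAt]
  intro p
  by_cases hp : p.2 = x
  · subst hp
    exact (contDiffAt_const (c := (0 : ℝ))).congr_of_eventuallyEq
      (sphericalWave_eventuallyEq_zero ha hχ0 p)
  · have hr : 0 < ‖p.2 - x‖ := norm_pos_iff.2 (sub_ne_zero.2 hp)
    have hn : ContDiffAt ℝ ∞ (fun q : ℝ × Space3 => ‖q.2 - x‖) p :=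
      (contDiffAt_snd.sub contDiffAt_const).norm ℝ (sub_ne_zero.2 hp)
    unfold sphericalWave
    refine ContDiffAt.div ?_ (contDiffAt_const.mul hn) (by positivity)
    exact (hh.contDiffAt.comp p (contDiffAt_fst.add (hn.div_const c))).mul (hχ.contDiffAt.comp p hn)

/-- The endpoint `r = a` is reached by continuity. Including it allows the lemma to be applied again
to `deriv χ`. -/
theorem deriv_eq_zero_of_le (hχ0 : ∀ r, r ≤ a → χ r = 0) (hχ : ContDiff ℝ ∞ χ) {r : ℝ}
    (hr : r ≤ a) : deriv χ r = 0 := by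
  have h1 : ∀ r < a, deriv χ r = 0 := by
    intro r hr
    have : χ =ᶠ[𝓝 r] fun _ => 0 := by
      filter_upwards [Iio_mem_nhds hr] with s hs using hχ0 s (le_of_lt hs)
    rw [this.deriv_eq, deriv_const]
  have h2 : Continuous (deriv χ) := hχ.continuous_deriv (by simp)
  have h3 : Set.EqOn (deriv χ) (fun _ => 0) (closure (Set.Iio a)) :=
    Set.EqOn.closure (fun r hr => h1 r hr) h2 continuous_const
  rw [closure_Iio] at h3
  exact h3 hr

/-- Off `x`, the wave `h(s + r/c)/r` solves the homogeneous equation exactly, so only terms with a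
derivative of the cut-off survive. Near `x` the wave vanishes identically. -/
theorem waveOp_sphericalWave (hc : c ≠ 0) (hh : ContDiff ℝ ∞ h) (hχ : ContDiff ℝ ∞ χ) (ha : 0 < a)
    (hχ0 : ∀ r, r ≤ a → χ r = 0) (x : Space3) (p : ℝ × Space3) :
    waveOp c (sphericalWave c h χ x) p = sphericalSource c h χ x p := by
  have hh' : ContDiff ℝ ∞ (deriv h) := (contDiff_infty_iff_deriv.1 hh).2
  have hχ' : ContDiff ℝ ∞ (deriv χ) := (contDiff_infty_iff_deriv.1 hχ).2
  have dh : ∀ r, HasDerivAt h (deriv h r) r := fun r =>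
    (hh.differentiable (by simp) r).hasDerivAt
  have dh' : ∀ r, HasDerivAt (deriv h) (deriv (deriv h) r) r := fun r =>
    (hh'.differentiable (by simp) r).hasDerivAt
  have dχ : ∀ r, HasDerivAt χ (deriv χ r) r := fun r =>
    (hχ.differentiable (by simp) r).hasDerivAt
  have dχ' : ∀ r, HasDerivAt (deriv χ) (deriv (deriv χ) r) r := fun r =>
    (hχ'.differentiable (by simp) r).hasDerivAt
  obtain ⟨s, y⟩ := p
  by_cases hy : y = x
  · subst hy
    have h0 := sphericalWave_eventuallyEq_zero (c := c) (h := h) ha hχ0 (s, y)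
    have h1 : (fun s' => sphericalWave c h χ y (s', y)) = fun _ => 0 := by
      ext s'
      simp [sphericalWave]
    have h2 : (fun y' => sphericalWave c h χ y (s, y')) =ᶠ[𝓝 y] fun _ => 0 :=
      (Continuous.tendsto (f := fun y' : Space3 => (s, y')) (by fun_prop) y).eventually h0
    have h3 : Δ (fun y' => sphericalWave c h χ y (s, y')) y = 0 :=
      (InnerProductSpace.laplacian_congr_nhds h2).eq_of_nhds.trans
        (congrFun InnerProductSpace.laplacian_const y)
    simp only [waveOp, sphericalSource, h1, h3]
    simp
  · have hr : 0 < ‖y - x‖ := norm_pos_iff.2 (sub_ne_zero.2 hy)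
    set r := ‖y - x‖ with hrdef
    have e1 : iteratedDeriv 2 (fun s => sphericalWave c h χ x (s, y)) s =
        deriv (deriv h) (s + r / c) * χ r / (4 * Real.pi * r) := by
      have d1 : deriv (fun s => sphericalWave c h χ x (s, y)) =
          fun s => deriv h (s + r / c) * χ r / (4 * Real.pi * r) := by
        ext s
        have : HasDerivAt (fun s => h (s + r / c) * χ r / (4 * Real.pi * r)) _ s :=
          (((dh _).comp_add_const s (r / c)).mul_const _).div_const _
        exact this.deriv
      rw [iteratedDeriv_succ, iteratedDeriv_one, d1]
      have : HasDerivAt (fun s => deriv h (s + r / c) * χ r / (4 * Real.pi * r)) _ s :=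
        (((dh' _).comp_add_const s (r / c)).mul_const _).div_const _
      exact this.deriv
    have e2 : Δ (fun y => sphericalWave c h χ x (s, y)) y =
        (deriv (deriv h) (s + r / c) * (1 / c) * (1 / c) * χ r
          + 2 * (deriv h (s + r / c) * (1 / c)) * deriv χ r
          + h (s + r / c) * deriv (deriv χ) r) / (4 * Real.pi) / r := by
      set G : ℝ → ℝ := fun r => h (s + r / c) * χ r / (4 * Real.pi) with hG
      have hGc : ContDiff ℝ 2 G := by
        have h1 : ContDiff ℝ 2 h := hh.of_le (WithTop.coe_le_coe.2 le_top)
        have h2 : ContDiff ℝ 2 χ := hχ.of_le (WithTop.coe_le_coe.2 le_top)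
        fun_prop
      have dl : ∀ r, HasDerivAt (fun r : ℝ => s + r / c) (1 / c) r := fun r =>
        ((hasDerivAt_id r).div_const c).const_add s
      have d1 : deriv G = fun r => (deriv h (s + r / c) * (1 / c) * χ r +
          h (s + r / c) * deriv χ r) / (4 * Real.pi) := by
        ext r
        exact ((((dh _).comp r (dl r)).mul (dχ r)).div_const _).deriv
      have d2 : HasDerivAt (fun r => (deriv h (s + r / c) * (1 / c) * χ r +
          h (s + r / c) * deriv χ r) / (4 * Real.pi)) _ r :=
        ((((((dh' _).comp r (dl r)).mul_const (1 / c)).mul (dχ r)).add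
          (((dh _).comp r (dl r)).mul (dχ' r))).div_const _)
      have e3 : (fun y => sphericalWave c h χ x (s, y)) = fun y => G ‖y - x‖ / ‖y - x‖ := by
        ext y
        simp only [sphericalWave, hG, div_div]
      rw [e3, laplacian_radial_div hGc hy, ← hrdef, d1, d2.deriv]
      simp only [Function.comp_apply]
      ring
    simp only [waveOp, sphericalSource, e1, e2, ← hrdef]
    field_simp
    ring

end

/-! ### The source of a cut-off spherical wave as an approximate identity -/

/-- Concentration at `p₀` of the rescaled copies of a compactly supported kernel. -/
theorem tendsto_setIntegral_scaled_kernel {V E : Type*} [NormedAddCommGroup V] [NormedSpace ℝ V]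
    [FiniteDimensional ℝ V] [MeasurableSpace V] [BorelSpace V] (μ : Measure V) [μ.IsAddHaarMeasure]
    [NormedAddCommGroup E] [NormedSpace ℝ E] [CompleteSpace E]
    {k : V → ℝ} (hk : Continuous k) {R : ℝ} (hR : 0 < R) (hkR : ∀ q, R < ‖q‖ → k q = 0)
    (hk1 : ∫ q, k q ∂μ = 1) {u : V → E} {p₀ : V} {U S : Set V} (hU : U ∈ 𝓝 p₀)
    (hu : ContinuousOn u U) (hUS : U ⊆ S) :
    Tendsto (fun ε : ℝ => ∫ p in S,
      ((ε ^ Module.finrank ℝ V)⁻¹ * k (ε⁻¹ • (p - p₀))) • u p ∂μ) (𝓝[>] 0) (𝓝 (u p₀)) := by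
  have hkc : HasCompactSupport k := HasCompactSupport.intro (isCompact_closedBall 0 R)
    (fun q hq => hkR q (by simpa using hq))
  have hki : Integrable k μ := hk.integrable_of_hasCompactSupport hkc
  set N : ℝ := ∫ q, ‖k q‖ ∂μ with hN
  have hN0 : 0 ≤ N := integral_nonneg fun _ => norm_nonneg _
  rw [Metric.tendsto_nhds]
  intro η hη
  -- The kernel may change sign, so its `L¹` norm `N` controls the error; `N + 1` keeps the quotient
  -- defined and the final inequality strict.
  have hη' : 0 < η / (N + 1) := by positivity
  have hcont : ContinuousAt u p₀ := hu.continuousAt hU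
  obtain ⟨δ, hδ, hδU⟩ := Metric.nhds_basis_closedBall.mem_iff.1
    (inter_mem hU (hcont.eventually (Metric.closedBall_mem_nhds _ hη')))
  have hev : ∀ᶠ ε : ℝ in 𝓝[>] 0, ε < δ / R :=
    nhdsWithin_le_nhds (Iio_mem_nhds (by positivity))
  filter_upwards [hev, self_mem_nhdsWithin] with ε hε1 hε
  rw [Set.mem_Ioi] at hε
  have hεR : ε * R < δ := by rwa [lt_div_iff₀ hR] at hε1
  have hmap : ∀ q, ‖q‖ ≤ R → p₀ + ε • q ∈ closedBall p₀ δ := by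
    intro q hq
    rw [mem_closedBall, dist_eq_norm, add_sub_cancel_left, norm_smul, Real.norm_eq_abs,
      abs_of_pos hε]
    nlinarith
  have e1 : ∫ p in S, ((ε ^ Module.finrank ℝ V)⁻¹ * k (ε⁻¹ • (p - p₀))) • u p ∂μ =
      ∫ p, ((ε ^ Module.finrank ℝ V)⁻¹ * k (ε⁻¹ • (p - p₀))) • u p ∂μ := by
    refine setIntegral_eq_integral_of_forall_compl_eq_zero fun p hp => ?_
    rw [hkR, mul_zero, zero_smul]
    by_contra h
    refine hp (hUS (hδU ?_).1)
    have := hmap _ (not_lt.1 h)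
    rwa [smul_inv_smul₀ hε.ne', add_sub_cancel] at this
  have e2 : ∫ p, ((ε ^ Module.finrank ℝ V)⁻¹ * k (ε⁻¹ • (p - p₀))) • u p ∂μ =
      ∫ q, k q • u (p₀ + ε • q) ∂μ := by
    have h1 := integral_sub_right_eq_self (μ := μ)
      (fun p => ((ε ^ Module.finrank ℝ V)⁻¹ * k (ε⁻¹ • p)) • u (p₀ + p)) p₀
    simp only [add_sub_cancel] at h1
    rw [h1]
    have h2 := Measure.integral_comp_inv_smul_of_nonneg μ
      (fun q => ((ε ^ Module.finrank ℝ V)⁻¹ * k q) • u (p₀ + ε • q)) hε.le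
    simp only [smul_inv_smul₀ hε.ne'] at h2
    rw [h2, ← integral_smul]
    refine integral_congr_ae (Eventually.of_forall fun q => ?_)
    simp only
    rw [smul_smul, ← mul_assoc, mul_inv_cancel₀ (by positivity), one_mul]
  have hint : Integrable (fun q => k q • u (p₀ + ε • q)) μ := by
    have h1 : ContinuousOn (fun q => k q • u (p₀ + ε • q)) (closedBall 0 R) := by
      refine hk.continuousOn.smul (hu.comp (by fun_prop) fun q hq => ?_)
      exact (hδU (hmap q (by simpa using hq))).1
    have h2 := h1.integrableOn_compact (μ := μ) (isCompact_closedBall 0 R)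
    rwa [integrableOn_iff_integrable_of_support_subset] at h2
    intro q hq
    by_contra h
    exact hq (by simp only; rw [hkR q (by simpa using h), zero_smul])
  have e3 : (∫ q, k q • u (p₀ + ε • q) ∂μ) - u p₀ =
      ∫ q, k q • (u (p₀ + ε • q) - u p₀) ∂μ := by
    simp only [smul_sub]
    rw [integral_sub hint (hki.smul_const _), integral_smul_const, hk1, one_smul]
  rw [e1, e2, dist_eq_norm, e3]
  calc ‖∫ q, k q • (u (p₀ + ε • q) - u p₀) ∂μ‖ ≤ ∫ q, ‖k q‖ * (η / (N + 1)) ∂μ := by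
        refine norm_integral_le_of_norm_le (hki.norm.mul_const _) (Eventually.of_forall fun q => ?_)
        rw [norm_smul]
        by_cases hq : ‖q‖ ≤ R
        · gcongr
          have := (hδU (hmap q hq)).2
          rwa [Set.mem_ofPred_eq, dist_eq_norm] at this
        · rw [hkR q (not_le.1 hq)]
          simp
    _ = N * (η / (N + 1)) := integral_mul_const _ _
    _ < η := by
        rw [mul_div_assoc', div_lt_iff₀ (by positivity)]
        nlinarith

theorem integral_deriv_eq_zero_of_bounded_support {h : ℝ → ℝ} (hh : ContDiff ℝ ∞ h)
    {R : ℝ} (hR : ∀ s, R < |s| → h s = 0) : ∫ s, deriv h s = 0 := by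
  have hd : ∀ s, HasDerivAt h (deriv h s) s := fun s =>
    (hh.differentiable (by simp) s).hasDerivAt
  have hc : HasCompactSupport h := HasCompactSupport.intro (isCompact_closedBall 0 R)
    (fun q hq => hR q (by simpa using hq))
  have hi : Integrable (deriv h) :=
    (hh.continuous_deriv (by simp)).integrable_of_hasCompactSupport hc.deriv
  have h1 : Tendsto h atBot (𝓝 0) := by
    refine tendsto_const_nhds.congr' ?_
    filter_upwards [eventually_lt_atBot (-|R|)] with s hs
    exact (hR s (by rw [abs_of_nonpos (by linarith [abs_nonneg R])]; linarith [le_abs_self R])).symm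
  have h2 : Tendsto h atTop (𝓝 0) := by
    refine tendsto_const_nhds.congr' ?_
    filter_upwards [eventually_gt_atTop |R|] with s hs
    exact (hR s (by rw [abs_of_nonneg (by linarith [abs_nonneg R])]; linarith [le_abs_self R])).symm
  simpa using integral_of_hasDerivAt_of_tendsto hd hi h1 h2

section

variable {c a b R : ℝ} {h χ : ℝ → ℝ}

theorem deriv_eq_zero_of_ge (hχ1 : ∀ r, b ≤ r → χ r = 1) (hχ : ContDiff ℝ ∞ χ) {r : ℝ}
    (hr : b ≤ r) : deriv χ r = 0 := by
  have h1 : ∀ r > b, deriv χ r = 0 := by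
    intro r hr
    have : χ =ᶠ[𝓝 r] fun _ => 1 := by
      filter_upwards [Ioi_mem_nhds hr] with s hs using hχ1 s (le_of_lt hs)
    rw [this.deriv_eq, deriv_const]
  have h3 : Set.EqOn (deriv χ) (fun _ => 0) (closure (Set.Ioi b)) :=
    Set.EqOn.closure (fun r hr => h1 r hr) (hχ.continuous_deriv (by simp)) continuous_const
  rw [closure_Ioi] at h3
  exact h3 hr

theorem deriv_deriv_eq_zero_of_ge (hχ1 : ∀ r, b ≤ r → χ r = 1) (hχ : ContDiff ℝ ∞ χ) {r : ℝ}
    (hr : b ≤ r) : deriv (deriv χ) r = 0 := by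
  have hχ' : ContDiff ℝ ∞ (deriv χ) := (contDiff_infty_iff_deriv.1 hχ).2
  have h1 : ∀ r > b, deriv (deriv χ) r = 0 := by
    intro r hr
    have : deriv χ =ᶠ[𝓝 r] fun _ => 0 := by
      filter_upwards [Ioi_mem_nhds hr] with s hs using deriv_eq_zero_of_ge hχ1 hχ (le_of_lt hs)
    rw [this.deriv_eq, deriv_const]
  have h3 : Set.EqOn (deriv (deriv χ)) (fun _ => 0) (closure (Set.Ioi b)) :=
    Set.EqOn.closure (fun r hr => h1 r hr) (hχ'.continuous_deriv (by simp)) continuous_const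
  rw [closure_Ioi] at h3
  exact h3 hr

theorem sphericalSource_eq_zero_of_ge (hχ1 : ∀ r, b ≤ r → χ r = 1) (hχ : ContDiff ℝ ∞ χ)
    {x : Space3} {p : ℝ × Space3} (hp : b ≤ ‖p.2 - x‖) : sphericalSource c h χ x p = 0 := by
  simp [sphericalSource, deriv_eq_zero_of_ge hχ1 hχ hp, deriv_deriv_eq_zero_of_ge hχ1 hχ hp]

theorem sphericalSource_eq_zero_of_time {s₁ s₂ : ℝ}
    (hs : ∀ s, s < s₁ ∨ s₂ < s → h s = 0) {x : Space3} {p : ℝ × Space3}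
    (hp : p.1 + ‖p.2 - x‖ / c < s₁ ∨ s₂ < p.1 + ‖p.2 - x‖ / c) : sphericalSource c h χ x p = 0 := by
  have h1 : ∀ s, s < s₁ ∨ s₂ < s → deriv h s = 0 := by
    intro s hs'
    have : h =ᶠ[𝓝 s] fun _ => 0 := by
      rcases hs' with h' | h'
      · filter_upwards [Iio_mem_nhds h'] with s hs' using hs s (Or.inl hs')
      · filter_upwards [Ioi_mem_nhds h'] with s hs' using hs s (Or.inr hs')
    rw [this.deriv_eq, deriv_const]
  simp [sphericalSource, h1 _ hp, hs _ hp]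

theorem sphericalSource_eq_zero_of_notMem (hc : 0 < c) (hχ : ContDiff ℝ ∞ χ)
    (hχ1 : ∀ r, b ≤ r → χ r = 1) (hR : ∀ s, R < |s| → h s = 0) {p : ℝ × Space3}
    (hp : p ∉ closedBall (0 : ℝ) (R + b / c) ×ˢ closedBall (0 : Space3) b) :
    sphericalSource c h χ 0 p = 0 := by
  by_contra hne
  have h1 : ‖p.2 - 0‖ < b := by
    by_contra h1
    exact hne (sphericalSource_eq_zero_of_ge hχ1 hχ (not_lt.1 h1))
  rw [sub_zero] at h1
  have h2 : |p.1 + ‖p.2 - 0‖ / c| ≤ R := by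
    by_contra h2
    refine hne (sphericalSource_eq_zero_of_time (s₁ := -R) (s₂ := R) (fun s hs => hR s ?_) ?_)
    · rw [lt_abs]
      rcases hs with hs | hs
      · right; linarith
      · left; exact hs
    · rw [not_le, lt_abs] at h2
      rcases h2 with h2 | h2
      · right; exact h2
      · left; linarith
  rw [sub_zero] at h2
  refine hp ⟨?_, by simpa using h1.le⟩
  have h3 : ‖p.2‖ / c ≤ b / c := by gcongr
  have h4 : 0 ≤ ‖p.2‖ / c := by positivity
  rw [abs_le] at h2
  rw [mem_closedBall_zero_iff, Real.norm_eq_abs, abs_le]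
  constructor <;> linarith [h2.1, h2.2]

/-- There is no pole at `x`: both derivatives of `χ` vanish for `r ≤ a`, so `r` may be replaced by
`max r a` in the denominator. -/
theorem continuous_sphericalSource (hh : ContDiff ℝ ∞ h) (hχ : ContDiff ℝ ∞ χ) (ha : 0 < a)
    (hχ0 : ∀ r, r ≤ a → χ r = 0) (x : Space3) : Continuous (sphericalSource c h χ x) := by
  have hh' : Continuous (deriv h) := hh.continuous_deriv (by simp)
  have hχ' : ContDiff ℝ ∞ (deriv χ) := (contDiff_infty_iff_deriv.1 hχ).2
  have hχ'' : Continuous (deriv (deriv χ)) := hχ'.continuous_deriv (by simp)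
  have hχc := hχ'.continuous
  have hhc := hh.continuous
  have e : sphericalSource c h χ x = fun p =>
      -(2 / c * deriv h (p.1 + ‖p.2 - x‖ / c) * deriv χ ‖p.2 - x‖ +
    h (p.1 + ‖p.2 - x‖ / c) * deriv (deriv χ) ‖p.2 - x‖) /
      (4 * Real.pi * max ‖p.2 - x‖ a) := by
    ext p
    rcases le_total ‖p.2 - x‖ a with hp | hp
    · simp [sphericalSource, deriv_eq_zero_of_le hχ0 hχ hp,
        deriv_eq_zero_of_le (fun r hr => deriv_eq_zero_of_le hχ0 hχ hr) hχ' hp]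
    · rw [sphericalSource, max_eq_left hp]
  rw [e]
  refine Continuous.div (by fun_prop) (by fun_prop) fun p => ?_
  have : 0 < max ‖p.2 - x‖ a := lt_max_of_lt_right ha
  positivity

/-- A regularized form of `-Δ(1/(4πr)) = δ`. Integration in time removes the term in `h'` and leaves
`-χ''(r)/(4πr)`. Its space integral is that of `-r χ''` over `(0, ∞)`, with primitive `χ - r χ'`
rising from 0 to 1. -/
theorem integral_sphericalSource (hc : 0 < c) (hh : ContDiff ℝ ∞ h) (hχ : ContDiff ℝ ∞ χ)
    (ha : 0 < a) (hχ0 : ∀ r, r ≤ a → χ r = 0) (hχ1 : ∀ r, b ≤ r → χ r = 1)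
    (hR : ∀ s, R < |s| → h s = 0) (hh1 : ∫ s, h s = 1) :
    ∫ p, sphericalSource c h χ 0 p = 1 := by
  have hχ' : ContDiff ℝ ∞ (deriv χ) := (contDiff_infty_iff_deriv.1 hχ).2
  have hcpt : HasCompactSupport (sphericalSource c h χ 0) := by
    refine HasCompactSupport.intro
      ((isCompact_closedBall (0 : ℝ) (R + b / c)).prod (isCompact_closedBall (0 : Space3) b))
      fun p hp => sphericalSource_eq_zero_of_notMem hc hχ hχ1 hR hp
  have hint : Integrable (sphericalSource c h χ 0) :=
    (continuous_sphericalSource hh hχ ha hχ0 0).integrable_of_hasCompactSupport hcpt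
  have hhc : HasCompactSupport h := HasCompactSupport.intro (isCompact_closedBall 0 R)
    (fun q hq => hR q (by simpa using hq))
  have hhi : Integrable h := hh.continuous.integrable_of_hasCompactSupport hhc
  have hhi' : Integrable (deriv h) :=
    (hh.continuous_deriv (by simp)).integrable_of_hasCompactSupport hhc.deriv
  have e1 : ∀ y : Space3, ∫ s, sphericalSource c h χ 0 (s, y) =
      -deriv (deriv χ) ‖y‖ / (4 * Real.pi * ‖y‖) := by
    intro y
    simp only [sphericalSource, sub_zero]
    rw [integral_div, integral_neg, integral_add, integral_mul_const, integral_mul_const,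
      integral_const_mul, integral_add_right_eq_self (deriv h), integral_add_right_eq_self h, hh1,
      integral_deriv_eq_zero_of_bounded_support hh hR]
    · simp
    · exact ((hhi'.comp_add_right _).const_mul _).mul_const _
    · exact (hhi.comp_add_right _).mul_const _
  rw [Measure.volume_eq_prod, integral_prod_symm _ (by rwa [← Measure.volume_eq_prod])]
  simp only [e1]
  have e2 := integral_fun_norm_addHaar (volume : Measure Space3)
    (fun r => -deriv (deriv χ) r / (4 * Real.pi * r))
  have hvol : (volume : Measure Space3).real (ball 0 1) = Real.pi * 4 / 3 := by
    rw [Measure.real, EuclideanSpace.volume_ball_fin_three]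
    simp only [ENNReal.ofReal_one, one_pow, one_mul]
    rw [ENNReal.toReal_ofReal (by positivity)]
  rw [e2, hvol]
  simp only [finrank_euclideanSpace, Fintype.card_fin, smul_eq_mul, nsmul_eq_mul]
  have hd : ∀ r, HasDerivAt (fun r => χ r - r * deriv χ r) (-(r * deriv (deriv χ) r)) r := by
    intro r
    have h1 : HasDerivAt χ (deriv χ r) r := (hχ.differentiable (by simp) r).hasDerivAt
    have h2 : HasDerivAt (deriv χ) (deriv (deriv χ) r) r :=
      (hχ'.differentiable (by simp) r).hasDerivAt
    refine (h1.sub ((hasDerivAt_id r).mul h2)).congr_deriv ?_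
    simp
  have hi : IntegrableOn (fun r => -(r * deriv (deriv χ) r)) (Set.Ioi 0) := by
    have hcont : Continuous fun r => -(r * deriv (deriv χ) r) := by
      have := hχ'.continuous_deriv (by simp)
      fun_prop
    refine (hcont.integrable_of_hasCompactSupport (HasCompactSupport.intro
      (isCompact_Icc (a := a) (b := b)) fun r hr => ?_)).integrableOn
    rw [Set.mem_Icc, not_and_or, not_le, not_le] at hr
    rcases hr with hr | hr
    · rw [deriv_eq_zero_of_le (fun r hr => deriv_eq_zero_of_le hχ0 hχ hr) hχ' hr.le]; simp
    · rw [deriv_deriv_eq_zero_of_ge hχ1 hχ hr.le]; simp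
  have htop : Tendsto (fun r => χ r - r * deriv χ r) atTop (𝓝 1) := by
    refine tendsto_const_nhds.congr' ?_
    filter_upwards [eventually_ge_atTop b] with r hr
    rw [hχ1 r hr, deriv_eq_zero_of_ge hχ1 hχ hr]
    simp
  have e3 := integral_Ioi_of_hasDerivAt_of_tendsto' (a := 0) (fun r _ => hd r) hi htop
  rw [hχ0 0 ha.le, zero_mul, sub_zero, sub_zero] at e3
  have e4 : ∫ r in Set.Ioi (0 : ℝ), r ^ (3 - 1) * (-deriv (deriv χ) r / (4 * Real.pi * r)) =
      ∫ r in Set.Ioi (0 : ℝ), 1 / (4 * Real.pi) * -(r * deriv (deriv χ) r) := by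
    refine setIntegral_congr_fun measurableSet_Ioi fun r hr => ?_
    have : r ≠ 0 := (Set.mem_Ioi.1 hr).ne'
    simp only [Nat.add_one_sub_one]
    field_simp
  rw [e4, integral_const_mul, e3]
  have := Real.pi_ne_zero
  push_cast
  field_simp

end

/-! ### The probing waves and recovery of the field from the source -/

/-- A smooth probability density on `(-1, 1)`. -/
def pulse : ℝ → ℝ :=
  (⟨1 / 2, 1, by norm_num, by norm_num⟩ : ContDiffBump (0 : ℝ)).normed volume

theorem contDiff_pulse : ContDiff ℝ ∞ pulse := ContDiffBump.contDiff_normed _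

theorem pulse_nonneg (s : ℝ) : 0 ≤ pulse s := ContDiffBump.nonneg_normed _ s

theorem integral_pulse : ∫ s, pulse s = 1 := ContDiffBump.integral_normed _

theorem pulse_eq_zero {s : ℝ} (hs : 1 < |s|) : pulse s = 0 := by
  have h := ContDiffBump.support_normed_eq (μ := (volume : Measure ℝ))
    (⟨1 / 2, 1, by norm_num, by norm_num⟩ : ContDiffBump (0 : ℝ))
  by_contra hne
  have h1 : s ∈ Function.support pulse := hne
  rw [pulse, h, mem_ball_zero_iff, Real.norm_eq_abs] at h1
  exact absurd hs (not_lt.2 h1.le)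

/-- A smooth function that is `0` on `(-∞, 1/2]` and `1` on `[1, ∞)`. -/
def cutoff (r : ℝ) : ℝ := Real.smoothTransition (2 * r - 1)

theorem contDiff_cutoff : ContDiff ℝ ∞ cutoff := by
  have : ContDiff ℝ ∞ Real.smoothTransition := Real.smoothTransition.contDiff
  unfold cutoff
  fun_prop

theorem cutoff_eq_zero {r : ℝ} (hr : r ≤ 1 / 2) : cutoff r = 0 :=
  Real.smoothTransition.zero_of_nonpos (by linarith)

theorem cutoff_eq_one {r : ℝ} (hr : 1 ≤ r) : cutoff r = 1 :=
  Real.smoothTransition.one_of_one_le (by linarith)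

/-- The density `pulse`, concentrated on `(t - ε, t + ε)`. -/
def scaledPulse (ε t s : ℝ) : ℝ := ε⁻¹ * pulse (ε⁻¹ * (s - t))

/-- The function `cutoff`, equal to `1` from `ε` on. -/
def scaledCutoff (ε r : ℝ) : ℝ := cutoff (ε⁻¹ * r)

theorem contDiff_scaledPulse (ε t : ℝ) : ContDiff ℝ ∞ (scaledPulse ε t) := by
  have := contDiff_pulse
  unfold scaledPulse
  fun_prop

theorem contDiff_scaledCutoff (ε : ℝ) : ContDiff ℝ ∞ (scaledCutoff ε) := by
  have := contDiff_cutoff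
  unfold scaledCutoff
  fun_prop

theorem scaledPulse_eq_zero {ε t s : ℝ} (hε : 0 < ε) (hs : ε < |s - t|) : scaledPulse ε t s = 0 := by
  rw [scaledPulse, pulse_eq_zero, mul_zero]
  rw [abs_mul, abs_of_pos (inv_pos.2 hε), inv_mul_eq_div, one_lt_div hε]
  exact hs

theorem scaledCutoff_eq_zero {ε r : ℝ} (hε : 0 < ε) (hr : r ≤ ε / 2) : scaledCutoff ε r = 0 := by
  refine cutoff_eq_zero ?_
  rw [inv_mul_eq_div, div_le_iff₀ hε]
  linarith

theorem scaledCutoff_eq_one {ε r : ℝ} (hε : 0 < ε) (hr : ε ≤ r) : scaledCutoff ε r = 1 := by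
  refine cutoff_eq_one ?_
  rwa [inv_mul_eq_div, one_le_div hε]

theorem deriv_scaledPulse (ε t s : ℝ) :
    deriv (scaledPulse ε t) s = ε⁻¹ * (ε⁻¹ * deriv pulse (ε⁻¹ * (s - t))) := by
  have h1 : HasDerivAt pulse (deriv pulse (ε⁻¹ * (s - t))) (ε⁻¹ * (s - t)) :=
    (contDiff_pulse.differentiable (by simp) _).hasDerivAt
  have h2 : HasDerivAt (fun s => ε⁻¹ * (s - t)) ε⁻¹ s := by
    simpa using ((hasDerivAt_id s).sub_const t).const_mul ε⁻¹
  have h3 : HasDerivAt (scaledPulse ε t) _ s := (h1.comp s h2).const_mul ε⁻¹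
  rw [h3.deriv]
  ring

theorem deriv_scaledCutoff (ε : ℝ) :
    deriv (scaledCutoff ε) = fun r => ε⁻¹ * deriv cutoff (ε⁻¹ * r) := by
  ext r
  exact deriv_comp_mul_left ε⁻¹ cutoff r

theorem deriv_deriv_scaledCutoff (ε r : ℝ) :
    deriv (deriv (scaledCutoff ε)) r = ε⁻¹ * (ε⁻¹ * deriv (deriv cutoff) (ε⁻¹ * r)) := by
  rw [deriv_scaledCutoff, deriv_const_mul_field]
  congr 1
  exact deriv_comp_mul_left ε⁻¹ (deriv cutoff) r

/-- The normalized pulse contributes `ε⁻¹`, the two derivatives `ε⁻²` and the factor `1/r` another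
`ε⁻¹`. The resulting power 4 is the dimension of space-time, so the kernels keep mass one. -/
theorem sphericalSource_scaled {c ε : ℝ} (hε : 0 < ε) (t : ℝ) (x : Space3) (p : ℝ × Space3) :
    sphericalSource c (scaledPulse ε t) (scaledCutoff ε) x p =
      (ε ^ 4)⁻¹ * sphericalSource c pulse cutoff 0 (ε⁻¹ • (p - (t, x))) := by
  have hn : ‖(ε⁻¹ • (p - (t, x))).2 - 0‖ = ε⁻¹ * ‖p.2 - x‖ := by
    rw [sub_zero, Prod.smul_snd, Prod.snd_sub, norm_smul, Real.norm_eq_abs,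
      abs_of_pos (inv_pos.2 hε)]
  have h1 : (ε⁻¹ • (p - (t, x))).1 + ε⁻¹ * ‖p.2 - x‖ / c = ε⁻¹ * (p.1 + ‖p.2 - x‖ / c - t) := by
    rw [Prod.smul_fst, Prod.fst_sub, smul_eq_mul]
    ring
  simp only [sphericalSource, hn, h1, deriv_scaledPulse, deriv_deriv_scaledCutoff]
  simp only [deriv_scaledCutoff, scaledPulse]
  rcases (norm_nonneg (p.2 - x)).eq_or_lt with h | h
  · simp [← h]
  · field_simp

theorem waveOp_sub {c : ℝ} {f g : ℝ × Space3 → ℝ} (hf : ContDiff ℝ ∞ f) (hg : ContDiff ℝ ∞ g)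
    (p : ℝ × Space3) : waveOp c (fun p => f p - g p) p = waveOp c f p - waveOp c g p := by
  have h2 : (2 : WithTop ℕ∞) ≤ ∞ := WithTop.coe_le_coe.2 le_top
  have hf2 : ContDiff ℝ 2 f := hf.of_le h2
  have hg2 : ContDiff ℝ 2 g := hg.of_le h2
  have ht : ∀ {f : ℝ × Space3 → ℝ}, ContDiff ℝ 2 f → ContDiffAt ℝ 2 (fun s => f (s, p.2)) p.1 :=
    fun hf => (hf.comp (contDiff_id.prodMk contDiff_const)).contDiffAt
  have hx : ∀ {f : ℝ × Space3 → ℝ}, ContDiff ℝ 2 f → ContDiffAt ℝ 2 (fun y => f (p.1, y)) p.2 :=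
    fun hf => (hf.comp (contDiff_const.prodMk contDiff_id)).contDiffAt
  have e1 : iteratedDeriv 2 (fun s => f (s, p.2) - g (s, p.2)) p.1 = _ :=
    iteratedDeriv_fun_sub (n := 2) (ht hf2) (ht hg2)
  have e2 : Δ (fun y => f (p.1, y) - g (p.1, y)) p.2 = _ := (hx hf2).laplacian_sub (hx hg2)
  simp only [waveOp, e1, e2]
  ring

/-- The test function that probes the wave field at time `t` and position `x`: a spherical wave
converging to `x`, minus its image in the plane `z = 0`. -/
def probeWave (c ε t : ℝ) (x : Space3) (p : ℝ × Space3) : ℝ :=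
  sphericalWave c (scaledPulse ε t) (scaledCutoff ε) x p -
    sphericalWave c (scaledPulse ε t) (scaledCutoff ε) (mirror x) p

section

variable {c ε t : ℝ} {x : Space3}

theorem contDiff_probeWave (hε : 0 < ε) : ContDiff ℝ ∞ (probeWave c ε t x) :=
  (contDiff_sphericalWave (contDiff_scaledPulse ε t) (contDiff_scaledCutoff ε) (half_pos hε)
    (fun _ => scaledCutoff_eq_zero hε) _).sub
  (contDiff_sphericalWave (contDiff_scaledPulse ε t) (contDiff_scaledCutoff ε) (half_pos hε)
    (fun _ => scaledCutoff_eq_zero hε) _)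

theorem sphericalWave_eq_zero {χ : ℝ → ℝ} (hε : 0 < ε) {p : ℝ × Space3}
    (hp : ε < |p.1 + ‖p.2 - x‖ / c - t|) : sphericalWave c (scaledPulse ε t) χ x p = 0 := by
  simp [sphericalWave, scaledPulse_eq_zero hε hp]

theorem isSourceTest_probeWave (hc : 0 < c) (hε : 0 < ε) (L : ℝ) :
    IsSourceTest L (probeWave c ε t x) := by
  -- The wave is nonzero at `y` only if `|s - (t - r/c)| ≤ ε`, and `r ≤ L + ‖x‖` on the sphere. As
  -- `mirror x` has the norm of `x`, one bound serves both waves.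
  refine ⟨(contDiff_probeWave hε).continuous, |t| + ε + (L + ‖x‖) / c, fun s y hy _ hs => ?_⟩
  have key : ∀ z : Space3, ‖z‖ = ‖x‖ → ε < |s + ‖y - z‖ / c - t| := by
    intro z hz
    have h1 : ‖y - z‖ / c ≤ (L + ‖x‖) / c := by
      have := norm_sub_le y z
      rw [hy, hz] at this
      gcongr
    have h2 : 0 ≤ ‖y - z‖ / c := by positivity
    have h3 := abs_sub_abs_le_abs_sub s (t - ‖y - z‖ / c)
    have h4 := abs_sub t (‖y - z‖ / c)
    rw [abs_of_nonneg h2] at h4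
    have h5 : s - (t - ‖y - z‖ / c) = s + ‖y - z‖ / c - t := by ring
    rw [h5] at h3
    linarith
  rw [probeWave, sphericalWave_eq_zero hε (key x rfl),
    sphericalWave_eq_zero hε (key (mirror x) (by simp)), sub_zero]

/-- Points of the plane are equidistant from `x` and its image, so the two waves cancel there. -/
theorem probeWave_dirichlet (s : ℝ) {y : Space3} (hy : y 2 = 0) :
    probeWave c ε t x (s, y) = 0 := by
  have h : ‖y - mirror x‖ = ‖y - x‖ := by
    rw [← mirror.norm_map (y - x), map_sub, mirror_of_apply_two_eq_zero hy]
  simp [probeWave, sphericalWave, h]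

theorem probeWave_late (hc : 0 < c) (hε : 0 < ε) {s : ℝ} (hs : t + 2 * ε ≤ s) (y : Space3) :
    probeWave c ε t x (s, y) = 0 := by
  have key : ∀ z : Space3, ε < |s + ‖y - z‖ / c - t| := by
    intro z
    have h2 : 0 ≤ ‖y - z‖ / c := by positivity
    exact lt_of_lt_of_le (by linarith) (le_abs_self _)
  rw [probeWave, sphericalWave_eq_zero hε (key x), sphericalWave_eq_zero hε (key (mirror x)),
    sub_zero]

/-- The image wave contributes nothing: its source lies within `ε` of `mirror x`, whereas points of
the upper half-space are farther than `x 2 ≥ ε` from it. -/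
theorem waveOp_probeWave (hc : 0 < c) (hε : 0 < ε) (hx : ε ≤ x 2) {p : ℝ × Space3}
    (hp : 0 < p.2 2) :
    waveOp c (probeWave c ε t x) p =
      (ε ^ 4)⁻¹ * sphericalSource c pulse cutoff 0 (ε⁻¹ • (p - (t, x))) := by
  have hP := contDiff_scaledPulse ε t
  have hC := contDiff_scaledCutoff ε
  have h0 : ∀ r, r ≤ ε / 2 → scaledCutoff ε r = 0 := fun _ => scaledCutoff_eq_zero hε
  have h1 : ε ≤ ‖p.2 - mirror x‖ := by
    have := PiLp.norm_apply_le (p.2 - mirror x) 2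
    rw [PiLp.sub_apply, mirror_apply_two, sub_neg_eq_add, Real.norm_eq_abs] at this
    have h2 := le_abs_self (p.2 2 + x 2)
    linarith
  have e := waveOp_sub (c := c) (contDiff_sphericalWave (c := c) hP hC (half_pos hε) h0 x)
    (contDiff_sphericalWave (c := c) hP hC (half_pos hε) h0 (mirror x)) p
  rw [waveOp_sphericalWave hc.ne' hP hC (half_pos hε) h0,
    waveOp_sphericalWave hc.ne' hP hC (half_pos hε) h0,
    sphericalSource_eq_zero_of_ge (fun r => scaledCutoff_eq_one hε) hC h1, sub_zero,
    sphericalSource_scaled hε] at e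
  exact e

theorem probeKernel_eq_zero (hc : 0 < c) {q : ℝ × Space3} (hq : 2 + 1 / c < ‖q‖) :
    sphericalSource c pulse cutoff 0 q = 0 := by
  refine sphericalSource_eq_zero_of_notMem (R := 1) (b := 1) hc contDiff_cutoff
    (fun _ => cutoff_eq_one) (fun _ => pulse_eq_zero) fun h => ?_
  rw [Set.mem_prod, mem_closedBall_zero_iff, mem_closedBall_zero_iff] at h
  have hc' : 0 < 1 / c := by positivity
  have : ‖q‖ ≤ 2 + 1 / c := by
    rw [Prod.norm_def]
    exact max_le (by linarith [h.1]) (by linarith [h.2])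
  linarith

/-- The value of the wave field at `(t, x)` as a limit of values of the source. -/
theorem tendsto_source_probeWave {Ω : Type*} [MeasurableSpace Ω] {P : Measure Ω} {L : ℝ}
    {n : (ℝ × Space3 → ℝ) → Lp ℝ 2 P} {u : ℝ → Space3 → Lp ℝ 2 P} (hc : 0 < c)
    (hu : IsCausalWaveField c L n u) (hx : 0 < x 2) (hxL : ‖x‖ ≠ L) :
    Tendsto (fun ε => n (probeWave c ε t x)) (𝓝[>] 0) (𝓝 (u t x)) := by
  have hR : 0 < 2 + 1 / c := by positivity
  have hopen : IsOpen {p : ℝ × Space3 | 0 < p.2 2 ∧ ‖p.2‖ ≠ L} :=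
    (isOpen_lt (g := fun p : ℝ × Space3 => p.2 2) continuous_const (by fun_prop)).inter
      (isOpen_ne_fun (f := fun p : ℝ × Space3 => ‖p.2‖) (by fun_prop) continuous_const)
  have hopen' : IsOpen {p : ℝ × Space3 | 0 < p.2 2} := isOpen_lt continuous_const (by fun_prop)
  have : (volume : Measure (ℝ × Space3)).IsAddHaarMeasure := by
    rw [Measure.volume_eq_prod]
    infer_instance
  have h := tendsto_setIntegral_scaled_kernel (volume : Measure (ℝ × Space3))
    (k := sphericalSource c pulse cutoff 0)
    (continuous_sphericalSource contDiff_pulse contDiff_cutoff one_half_pos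
      (fun _ => cutoff_eq_zero) 0)
    hR (fun q hq => probeKernel_eq_zero hc hq)
    (integral_sphericalSource hc contDiff_pulse contDiff_cutoff one_half_pos
      (fun _ => cutoff_eq_zero) (fun _ => cutoff_eq_one) (R := 1) (fun _ => pulse_eq_zero)
      integral_pulse)
    (u := fun p => u p.1 p.2) (p₀ := (t, x)) (hopen.mem_nhds ⟨hx, hxL⟩)
    (hu.continuousOn.mono fun p hp => ⟨hp.1.le, hp.2⟩)
    (S := {p | 0 < p.2 2}) (fun p hp => hp.1)
  have hrank : Module.finrank ℝ (ℝ × Space3) = 4 := by simp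
  rw [hrank] at h
  refine h.congr' ?_
  have hev1 : ∀ᶠ ε : ℝ in 𝓝[>] 0, ε < x 2 := nhdsWithin_le_nhds (Iio_mem_nhds hx)
  -- This keeps the ball of radius `ε (2 + 1/c)`, which contains the support of the rescaled kernel,
  -- inside the open half-space.
  have hev2 : ∀ᶠ ε : ℝ in 𝓝[>] 0, ε < x 2 / (2 + 1 / c) :=
    nhdsWithin_le_nhds (Iio_mem_nhds (by positivity))
  filter_upwards [hev1, hev2, self_mem_nhdsWithin] with ε h1 h2 hε
  rw [Set.mem_Ioi] at hε
  rw [lt_div_iff₀ hR] at h2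
  -- The probing wave extends into the infinite past; only its source is confined to a compact set,
  -- as the weak equation requires.
  rw [← hu.wave_equation _ (contDiff_probeWave hε) (isSourceTest_probeWave hc hε L)
    (fun s y hy => probeWave_dirichlet s hy)
    ⟨t + 2 * ε, fun s y hs _ => probeWave_late hc hε hs y⟩
    ⟨closedBall (t, x) (ε * (2 + 1 / c)), isCompact_closedBall _ _, ?_, ?_⟩]
  · refine setIntegral_congr_fun hopen'.measurableSet fun p hp => ?_
    simp only [waveOp_probeWave hc hε h1.le hp]
  · intro p hp
    rw [mem_closedBall, dist_eq_norm] at hp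
    have a1 := (PiLp.norm_apply_le (p - (t, x)).2 2).trans ((norm_snd_le _).trans hp)
    rw [Prod.snd_sub, PiLp.sub_apply, Real.norm_eq_abs, abs_le] at a1
    rw [Set.mem_ofPred_eq]
    linarith [a1.1]
  · intro p hp hpC
    rw [waveOp_probeWave hc hε h1.le hp, probeKernel_eq_zero hc, mul_zero]
    rw [mem_closedBall, dist_eq_norm, not_le] at hpC
    rw [norm_smul, norm_inv, Real.norm_eq_abs, abs_of_pos hε, inv_mul_eq_div, lt_div_iff₀ hε]
    linarith

end

/-! ### Smoothed time covariance and the covariance of the field -/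

theorem continuous_integral_pulse_mul {X : Type*} [TopologicalSpace X] [FirstCountableTopology X]
    [LocallyCompactSpace X] {f : X → ℝ → ℝ} (hf : Continuous f.uncurry) :
    Continuous fun x => ∫ σ, pulse σ * f x σ := by
  have hp := contDiff_pulse.continuous
  have h1 : ∀ x, ∫ σ in Set.Icc (-1 : ℝ) 1, pulse σ * f x σ = ∫ σ, pulse σ * f x σ := by
    intro x
    refine setIntegral_eq_integral_of_forall_compl_eq_zero fun σ hσ => ?_
    rw [pulse_eq_zero, zero_mul]
    by_contra h
    exact hσ (abs_le.1 (not_lt.1 h))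
  simp only [← h1]
  refine continuous_parametric_integral_of_continuous (f := fun x σ => pulse σ * f x σ) ?_
    isCompact_Icc
  exact (hp.comp continuous_snd).mul hf

theorem integrable_pulse : Integrable pulse := ContDiffBump.integrable_normed _

theorem abs_integral_pulse_mul_le {g : ℝ → ℝ} {C : ℝ} (hC : ∀ s, |g s| ≤ C) :
    |∫ σ, pulse σ * g σ| ≤ C := by
  have h : ‖∫ σ, pulse σ * g σ‖ ≤ ∫ σ, pulse σ * C := by
    refine norm_integral_le_of_norm_le (integrable_pulse.mul_const C)
      (Eventually.of_forall fun σ => ?_)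
    rw [norm_mul, Real.norm_eq_abs, Real.norm_eq_abs, abs_of_nonneg (pulse_nonneg σ)]
    exact mul_le_mul_of_nonneg_left (hC σ) (pulse_nonneg σ)
  rwa [integral_mul_const, integral_pulse, one_mul] at h

theorem integral_scaledPulse_mul {ε : ℝ} (hε : 0 < ε) (t b : ℝ) (G : ℝ → ℝ) :
    ∫ s, scaledPulse ε t (s + b) * G s = ∫ σ, pulse σ * G (t - b + ε * σ) := by
  have h1 := integral_sub_right_eq_self (μ := (volume : Measure ℝ))
    (fun s => ε⁻¹ * (pulse (ε⁻¹ * s) * G (t - b + s))) (t - b)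
  have h2 := Measure.integral_comp_inv_mul_left
    (fun σ => ε⁻¹ * (pulse σ * G (t - b + ε * σ))) ε
  simp only [mul_inv_cancel_left₀ hε.ne'] at h2
  rw [h2, integral_const_mul ε⁻¹ (fun σ => pulse σ * G (t - b + ε * σ)), abs_of_pos hε, smul_eq_mul,
    mul_inv_cancel_left₀ hε.ne'] at h1
  rw [← h1]
  refine integral_congr_ae (Eventually.of_forall fun s => ?_)
  have e1 : s + b - t = s - (t - b) := by ring
  simp only [scaledPulse, e1, add_sub_cancel, mul_assoc]

theorem integrable_scaledPulse_mul {ε : ℝ} (hε : 0 < ε) (t b : ℝ) {G : ℝ → ℝ} (hG : Continuous G) :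
    Integrable fun s => scaledPulse ε t (s + b) * G s := by
  have hp := (contDiff_scaledPulse ε t).continuous
  refine Continuous.integrable_of_hasCompactSupport (by fun_prop)
    (HasCompactSupport.intro (isCompact_closedBall (t - b) ε) fun s hs => ?_)
  rw [scaledPulse_eq_zero hε, zero_mul]
  rw [mem_closedBall, Real.dist_eq, not_le] at hs
  rwa [show s + b - t = s - (t - b) by ring]

/-- The covariance `F`, smoothed in one of its time variables. -/
def smoothedOnce (F : ℝ → ℝ) (ε a : ℝ) : ℝ := ∫ σ, pulse σ * F (a - ε * σ)

/-- The covariance `F`, smoothed in both time variables. -/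
def smoothedTwice (F : ℝ → ℝ) (ε a : ℝ) : ℝ := ∫ σ, pulse σ * smoothedOnce F ε (a + ε * σ)

section

variable {F : ℝ → ℝ} {C : ℝ}

theorem continuous_smoothedOnce (hF : Continuous F) :
    Continuous fun p : ℝ × ℝ => smoothedOnce F p.1 p.2 :=
  continuous_integral_pulse_mul (X := ℝ × ℝ) (f := fun p σ => F (p.2 - p.1 * σ))
    (by unfold Function.uncurry; fun_prop)

theorem continuous_smoothedTwice (hF : Continuous F) :
    Continuous fun p : ℝ × ℝ => smoothedTwice F p.1 p.2 := by
  refine continuous_integral_pulse_mul (X := ℝ × ℝ)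
    (f := fun p σ => smoothedOnce F p.1 (p.2 + p.1 * σ)) ?_
  exact (continuous_smoothedOnce hF).comp
    (show Continuous fun q : (ℝ × ℝ) × ℝ => (q.1.1, q.1.2 + q.1.1 * q.2) by fun_prop)

/-- Since `smoothedTwice` is jointly continuous up to `ε = 0`, this value identifies the limit of
vanishing pulse width. -/
theorem smoothedTwice_zero (a : ℝ) : smoothedTwice F 0 a = F a := by
  simp [smoothedTwice, smoothedOnce, integral_mul_const, integral_pulse]

theorem abs_smoothedTwice_le (hC : ∀ v, |F v| ≤ C) (ε a : ℝ) : |smoothedTwice F ε a| ≤ C :=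
  abs_integral_pulse_mul_le fun _ => abs_integral_pulse_mul_le fun _ => hC _

/-- The covariance of two differences of time pulses. -/
theorem integral_integral_pulses (hF : Continuous F) {ε : ℝ} (hε : 0 < ε)
    (t t' α β α' β' a b a' b' : ℝ) :
    ∫ s, ∫ s', F (s - s') * (α * scaledPulse ε t (s + a) - β * scaledPulse ε t (s + b)) *
        (α' * scaledPulse ε t' (s' + a') - β' * scaledPulse ε t' (s' + b')) =
      α * α' * smoothedTwice F ε (t - a - (t' - a')) -
        α * β' * smoothedTwice F ε (t - a - (t' - b')) -
        β * α' * smoothedTwice F ε (t - b - (t' - a')) +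
        β * β' * smoothedTwice F ε (t - b - (t' - b')) := by
  have hM : ∀ e : ℝ, Continuous fun s => smoothedOnce F ε (s - e) := fun e =>
    (continuous_smoothedOnce hF).comp (show Continuous fun s : ℝ => (ε, s - e) by fun_prop)
  have e1 : ∀ s e : ℝ, ∫ s', scaledPulse ε t' (s' + e) * F (s - s') =
      smoothedOnce F ε (s - (t' - e)) := by
    intro s e
    rw [integral_scaledPulse_mul hε, smoothedOnce]
    simp only [sub_sub]
  have i1 : ∀ s e : ℝ, Integrable fun s' => scaledPulse ε t' (s' + e) * F (s - s') := fun s e =>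
    integrable_scaledPulse_mul hε t' e (by fun_prop)
  have e2 : ∀ s, ∫ s', F (s - s') * (α * scaledPulse ε t (s + a) - β * scaledPulse ε t (s + b)) *
      (α' * scaledPulse ε t' (s' + a') - β' * scaledPulse ε t' (s' + b')) =
      (α * scaledPulse ε t (s + a) - β * scaledPulse ε t (s + b)) *
        (α' * smoothedOnce F ε (s - (t' - a')) - β' * smoothedOnce F ε (s - (t' - b'))) := by
    intro s
    rw [← e1, ← e1, ← integral_const_mul, ← integral_const_mul,
      ← integral_sub ((i1 s a').const_mul _) ((i1 s b').const_mul _), ← integral_const_mul]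
    refine integral_congr_ae (Eventually.of_forall fun s' => ?_)
    simp only
    ring
  simp only [e2]
  have e3 : ∀ e e' : ℝ, ∫ s, scaledPulse ε t (s + e) * smoothedOnce F ε (s - (t' - e')) =
      smoothedTwice F ε (t - e - (t' - e')) := by
    intro e e'
    rw [integral_scaledPulse_mul hε, smoothedTwice]
    refine integral_congr_ae (Eventually.of_forall fun σ => ?_)
    simp only
    ring_nf
  have i3 : ∀ e e' : ℝ, Integrable fun s =>
      scaledPulse ε t (s + e) * smoothedOnce F ε (s - (t' - e')) := fun e e' =>
    integrable_scaledPulse_mul hε t e (hM _)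
  rw [← e3, ← e3, ← e3, ← e3, ← integral_const_mul, ← integral_const_mul, ← integral_const_mul,
    ← integral_const_mul, ← integral_sub ((i3 a a').const_mul _) ((i3 a b').const_mul _),
    ← integral_sub _ ((i3 b a').const_mul _), ← integral_add _ ((i3 b b').const_mul _)]
  · refine integral_congr_ae (Eventually.of_forall fun s => ?_)
    simp only
    ring
  · exact (((i3 a a').const_mul _).sub ((i3 a b').const_mul _)).sub ((i3 b a').const_mul _)
  · exact ((i3 a a').const_mul _).sub ((i3 a b').const_mul _)

end

section

variable {f : ℝ → ℝ} {C L : ℝ} {x x' : Space3}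

theorem measurable_sourceCovariance (hf : Continuous f) (x x' : Space3) :
    Measurable (sourceCovariance f x x') := by
  have := hf.measurable
  unfold sourceCovariance
  fun_prop

theorem norm_sourceCovariance_le (hC : ∀ v, |f v| ≤ C) (hx : ‖x‖ < L) (hx' : ‖x'‖ < L)
    {y : Space3} (hy : ‖y‖ = L) :
    ‖sourceCovariance f x x' y‖ ≤ C / (16 * Real.pi ^ 2 * ((L - ‖x‖) * (L - ‖x'‖))) := by
  have hC0 : 0 ≤ C := (abs_nonneg _).trans (hC 0)
  have h1 : L - ‖x‖ ≤ ‖y - x‖ := hy ▸ norm_sub_norm_le y x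
  have h2 : L - ‖x'‖ ≤ ‖y - x'‖ := hy ▸ norm_sub_norm_le y x'
  have h3 : 0 < L - ‖x‖ := by linarith
  have h4 : 0 < L - ‖x'‖ := by linarith
  rw [sourceCovariance, norm_div, Real.norm_eq_abs, Real.norm_eq_abs,
    abs_of_nonneg (by positivity : 0 ≤ 16 * Real.pi ^ 2 * (‖y - x‖ * ‖y - x'‖))]
  gcongr
  exact hC _

theorem isFiniteMeasure_hemisphereMeasure (hL : 0 < L) : IsFiniteMeasure (hemisphereMeasure L) :=
  ⟨hemisphereMeasure_univ_lt_top hL⟩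

theorem integrable_sourceCovariance (hL : 0 < L) (hf : Continuous f) (hC : ∀ v, |f v| ≤ C)
    (hx : ‖x‖ < L) (hx' : ‖x'‖ < L) :
    Integrable (sourceCovariance f x x') (hemisphereMeasure L) := by
  have := isFiniteMeasure_hemisphereMeasure hL
  refine Integrable.of_bound (measurable_sourceCovariance hf x x').aestronglyMeasurable
    (C / (16 * Real.pi ^ 2 * ((L - ‖x‖) * (L - ‖x'‖)))) ?_
  filter_upwards [ae_hemisphereMeasure hL] with y hy using norm_sourceCovariance_le hC hx hx' hy.1

theorem tendsto_integral_sourceCovariance_of_tendsto {g : ℝ → ℝ → ℝ} (hL : 0 < L)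
    (hg : ∀ ε, Continuous (g ε)) (hC : ∀ ε v, |g ε v| ≤ C)
    (hgf : ∀ v, Tendsto (fun ε => g ε v) (𝓝[>] 0) (𝓝 (f v)))
    (hx : ‖x‖ < L) (hx' : ‖x'‖ < L) :
    Tendsto (fun ε => ∫ y, sourceCovariance (g ε) x x' y ∂(hemisphereMeasure L)) (𝓝[>] 0)
      (𝓝 (∫ y, sourceCovariance f x x' y ∂(hemisphereMeasure L))) := by
  have := isFiniteMeasure_hemisphereMeasure hL
  refine tendsto_integral_filter_of_dominated_convergence
    (fun _ => C / (16 * Real.pi ^ 2 * ((L - ‖x‖) * (L - ‖x'‖)))) ?_ ?_ (integrable_const _) ?_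
  · exact Eventually.of_forall fun ε =>
      (measurable_sourceCovariance (hg ε) x x').aestronglyMeasurable
  · refine Eventually.of_forall fun ε => ?_
    filter_upwards [ae_hemisphereMeasure hL] with y hy using
      norm_sourceCovariance_le (hC ε) hx hx' hy.1
  · exact Eventually.of_forall fun y => (hgf _).div_const _

end

/-- Both cut-offs equal 1 at such `y`. On the source sphere the probing wave is thus a difference of
two pulses in time, with constant amplitudes and delays. -/
theorem probeWave_eq_of_far {c ε t : ℝ} {x y : Space3} (hε : 0 < ε) (h : ε ≤ ‖y‖ - ‖x‖) (s : ℝ) :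
    probeWave c ε t x (s, y) =
      (4 * Real.pi * ‖y - x‖)⁻¹ * scaledPulse ε t (s + ‖y - x‖ / c) -
        (4 * Real.pi * ‖y - mirror x‖)⁻¹ * scaledPulse ε t (s + ‖y - mirror x‖ / c) := by
  have h1 : ε ≤ ‖y - x‖ := h.trans (norm_sub_norm_le y x)
  have h2 : ε ≤ ‖y - mirror x‖ := by
    have := norm_sub_norm_le y (mirror x)
    rw [LinearIsometryEquiv.norm_map] at this
    exact h.trans this
  simp only [probeWave, sphericalWave, scaledCutoff_eq_one hε h1, scaledCutoff_eq_one hε h2]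
  ring

/-- The covariance of the wave field at two points inside the half-sphere of the sources. -/
theorem integral_field_mul_field {Ω : Type*} [MeasurableSpace Ω] {P : Measure Ω} {c L : ℝ}
    {F : ℝ → ℝ} {n : (ℝ × Space3 → ℝ) → Lp ℝ 2 P} {u : ℝ → Space3 → Lp ℝ 2 P} (hc : 0 < c)
    (hF : Continuous F) {C : ℝ} (hC : ∀ v, |F v| ≤ C) (hL : 0 < L)
    (hn : IsNoiseSource P F L n) (hu : IsCausalWaveField c L n u)
    (t t' : ℝ) {x x' : Space3} (hx : 0 < x 2) (hx' : 0 < x' 2) (hxL : ‖x‖ < L) (hxL' : ‖x'‖ < L) :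
    ∫ a, u t x a * u t' x' a ∂P =
      (∫ y, sourceCovariance (fun v => F (t - t' + v / c)) x x' y ∂(hemisphereMeasure L))
        - (∫ y, sourceCovariance (fun v => F (t - t' + v / c)) x (mirror x') y
            ∂(hemisphereMeasure L))
        - (∫ y, sourceCovariance (fun v => F (t - t' + v / c)) (mirror x) x' y
            ∂(hemisphereMeasure L))
        + (∫ y, sourceCovariance (fun v => F (t - t' + v / c)) (mirror x) (mirror x') y
            ∂(hemisphereMeasure L)) := by
  set g : ℝ → ℝ → ℝ := fun ε v => smoothedTwice F ε (t - t' + v / c) with hg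
  have hgc : ∀ ε, Continuous (g ε) := fun ε => (continuous_smoothedTwice hF).comp
    (show Continuous fun v : ℝ => (ε, t - t' + v / c) by fun_prop)
  have hgC : ∀ ε v, |g ε v| ≤ C := fun ε v => abs_smoothedTwice_le hC _ _
  have hgl : ∀ v, Tendsto (fun ε => g ε v) (𝓝[>] 0) (𝓝 (F (t - t' + v / c))) := by
    intro v
    have h1 : Continuous fun ε => g ε v := (continuous_smoothedTwice hF).comp
      (show Continuous fun ε : ℝ => (ε, t - t' + v / c) by fun_prop)
    have h2 := (h1.tendsto 0).mono_left (nhdsWithin_le_nhds (s := Set.Ioi 0))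
    have e0 : g 0 v = F (t - t' + v / c) := smoothedTwice_zero _
    rwa [e0] at h2
  have hmL : ‖mirror x‖ < L := by rwa [LinearIsometryEquiv.norm_map]
  have hmL' : ‖mirror x'‖ < L := by rwa [LinearIsometryEquiv.norm_map]
  have l1 := (((tendsto_integral_sourceCovariance_of_tendsto hL hgc hgC hgl hxL hxL').sub
    (tendsto_integral_sourceCovariance_of_tendsto hL hgc hgC hgl hxL hmL')).sub
    (tendsto_integral_sourceCovariance_of_tendsto hL hgc hgC hgl hmL hxL')).add
    (tendsto_integral_sourceCovariance_of_tendsto hL hgc hgC hgl hmL hmL')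
  -- Continuity of the `L²` inner product carries mean-square convergence over to covariances. The
  -- limits `l1` and `l2` are then identified by uniqueness.
  have l2 := (tendsto_source_probeWave (t := t) hc hu hx hxL.ne).inner (𝕜 := ℝ)
    (tendsto_source_probeWave (t := t') hc hu hx' hxL'.ne)
  have hin : ∀ f g : Lp ℝ 2 P, inner ℝ f g = ∫ a, f a * g a ∂P := by
    intro f g
    rw [L2.inner_def]
    refine integral_congr_ae (Eventually.of_forall fun a => ?_)
    simp [mul_comm]
  simp only [hin] at l2
  refine tendsto_nhds_unique l2 (l1.congr' ?_)
  have hev1 : ∀ᶠ ε : ℝ in 𝓝[>] 0, ε < L - ‖x‖ :=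
    nhdsWithin_le_nhds (Iio_mem_nhds (by linarith))
  have hev2 : ∀ᶠ ε : ℝ in 𝓝[>] 0, ε < L - ‖x'‖ :=
    nhdsWithin_le_nhds (Iio_mem_nhds (by linarith))
  filter_upwards [hev1, hev2, self_mem_nhdsWithin] with ε h1 h2 hε
  rw [Set.mem_Ioi] at hε
  rw [hn.covariance _ _ (isSourceTest_probeWave hc hε L) (isSourceTest_probeWave hc hε L)]
  have i1 := integrable_sourceCovariance hL (hgc ε) (hgC ε) hxL hxL'
  have i2 := integrable_sourceCovariance hL (hgc ε) (hgC ε) hxL hmL'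
  have i3 := integrable_sourceCovariance hL (hgc ε) (hgC ε) hmL hxL'
  have i4 := integrable_sourceCovariance hL (hgc ε) (hgC ε) hmL hmL'
  rw [← integral_sub' i1 i2, ← integral_sub' (i1.sub i2) i3,
    ← integral_add' ((i1.sub i2).sub i3) i4]
  refine integral_congr_ae ?_
  filter_upwards [ae_hemisphereMeasure hL] with y hy
  have f1 : ∀ s, probeWave c ε t x (s, y) = _ := probeWave_eq_of_far hε (by rw [hy.1]; exact h1.le)
  have f2 : ∀ s, probeWave c ε t' x' (s, y) = _ :=
    probeWave_eq_of_far hε (by rw [hy.1]; exact h2.le)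
  simp only [f1, f2]
  rw [integral_integral_pulses hF hε]
  simp only [Pi.add_apply, Pi.sub_apply, sourceCovariance, hg]
  have e : ∀ r r' : ℝ, t - r / c - (t' - r' / c) = t - t' + (r' - r) / c := by
    intro r r'; ring
  have e' : ∀ r r' z : ℝ, (4 * Real.pi * r)⁻¹ * (4 * Real.pi * r')⁻¹ * z =
      z / (16 * Real.pi ^ 2 * (r * r')) := by
    intro r r' z
    rw [← mul_inv, div_eq_mul_inv, mul_comm]
    congr 2
    ring
  simp only [e, e']

/-! ### Spectral representation and the sinc kernel -/

theorem integral_exp_mul_I_unit_interval (r : ℝ) :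
    ∫ v in (-1 : ℝ)..1, Complex.exp ((v * r : ℝ) * Complex.I) = 2 * Real.sinc r := by
  rcases eq_or_ne r 0 with rfl | hr
  · simp
    norm_num
  · rw [intervalIntegral.integral_comp_mul_right (fun v : ℝ => Complex.exp (v * Complex.I)) hr,
      neg_one_mul, one_mul, integral_exp_mul_I_eq_sinc, Complex.real_smul]
    have : (r : ℂ) ≠ 0 := by exact_mod_cast hr
    push_cast
    field_simp

section

variable {F Fhat : ℝ → ℝ}

/-- As `F` and `Fhat` are both real, conjugation reverses the sign in the exponential. This
reconciles the Fourier convention for `F` with the `exp(ikt)` of `sincIntegral`. -/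
theorem spectral_conj
    (hF : ∀ t : ℝ, (F t : ℂ) =
      1 / (2 * (Real.pi : ℂ)) * ∫ k : ℝ, (Fhat k : ℂ) * Complex.exp (-(Complex.I * k * t)))
    (t : ℝ) :
    (F t : ℂ) = 1 / (2 * (Real.pi : ℂ)) *
      ∫ k : ℝ, (Fhat k : ℂ) * Complex.exp ((k * t : ℝ) * Complex.I) := by
  have h := congrArg (starRingEnd ℂ) (hF t)
  rw [Complex.conj_ofReal, map_mul, ← integral_conj] at h
  rw [h]
  congr 1
  · simp [Complex.conj_ofNat]
  · refine integral_congr_ae (Eventually.of_forall fun k => ?_)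
    simp only [map_mul, Complex.conj_ofReal, ← Complex.exp_conj, map_neg, Complex.conj_I]
    push_cast
    ring_nf

theorem abs_le_of_spectral
    (hF : ∀ t : ℝ, (F t : ℂ) =
      1 / (2 * (Real.pi : ℂ)) * ∫ k : ℝ, (Fhat k : ℂ) * Complex.exp (-(Complex.I * k * t)))
    (t : ℝ) : |F t| ≤ 1 / (2 * Real.pi) * ∫ k, ‖Fhat k‖ := by
  rw [← Real.norm_eq_abs, ← Complex.norm_real, spectral_conj hF t, norm_mul]
  have h1 : ‖(1 / (2 * (Real.pi : ℂ)))‖ = 1 / (2 * Real.pi) := by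
    simp [abs_of_pos Real.pi_pos]
  rw [h1]
  gcongr
  refine (norm_integral_le_integral_norm _).trans (le_of_eq ?_)
  refine integral_congr_ae (Eventually.of_forall fun k => ?_)
  simp only [norm_mul, Complex.norm_real, Complex.norm_exp_ofReal_mul_I, mul_one]

theorem continuous_of_spectral (hFhat : Integrable Fhat)
    (hF : ∀ t : ℝ, (F t : ℂ) =
      1 / (2 * (Real.pi : ℂ)) * ∫ k : ℝ, (Fhat k : ℂ) * Complex.exp (-(Complex.I * k * t))) :
    Continuous F := by
  have h : Continuous fun t : ℝ => (F t : ℂ) := by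
    simp only [spectral_conj hF]
    refine continuous_const.mul (continuous_of_dominated (bound := fun k => ‖Fhat k‖) ?_ ?_
      hFhat.norm ?_)
    · intro t
      exact hFhat.ofReal.aestronglyMeasurable.mul
        (Continuous.aestronglyMeasurable (by fun_prop))
    · intro t
      refine Eventually.of_forall fun k => le_of_eq ?_
      rw [norm_mul, Complex.norm_exp_ofReal_mul_I, mul_one, Complex.norm_real]
    · exact Eventually.of_forall fun k => by fun_prop
  exact Complex.continuous_re.comp h

/-- The frequency integral with the sinc kernel as an average of the covariance function. -/
theorem sincIntegral_eq (hFhat : Integrable Fhat)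
    (hF : ∀ t : ℝ, (F t : ℂ) =
      1 / (2 * (Real.pi : ℂ)) * ∫ k : ℝ, (Fhat k : ℂ) * Complex.exp (-(Complex.I * k * t)))
    (c d t : ℝ) :
    sincIntegral Fhat c d t =
      ((1 / (8 * Real.pi) * ∫ v in (-1 : ℝ)..1, F (v / c * d + t) : ℝ) : ℂ) := by
  rw [Complex.ofReal_mul, ← intervalIntegral.integral_ofReal]
  simp only [spectral_conj hF]
  -- Fubini applies because the exponential has modulus 1, `Fhat` is integrable and `v` ranges over
  -- a bounded interval.
  rw [intervalIntegral.integral_const_mul, intervalIntegral_integral_swap]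
  · have e : ∀ k : ℝ, ∫ v in (-1 : ℝ)..1, (Fhat k : ℂ) *
        Complex.exp ((k * (v / c * d + t) : ℝ) * Complex.I) =
        2 * ((Fhat k : ℂ) * (Real.sinc (k / c * d) : ℂ) * Complex.exp (Complex.I * k * t)) := by
      intro k
      have e1 : ∀ v : ℝ, Complex.exp ((k * (v / c * d + t) : ℝ) * Complex.I) =
          Complex.exp (Complex.I * k * t) *
            Complex.exp ((v * (k / c * d) : ℝ) * Complex.I) := by
        intro v
        rw [← Complex.exp_add]
        congr 1
        push_cast
        ring
      simp only [e1]
      rw [intervalIntegral.integral_const_mul, intervalIntegral.integral_const_mul,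
        integral_exp_mul_I_unit_interval]
      ring
    simp only [e]
    rw [integral_const_mul, sincIntegral]
    have : (Real.pi : ℂ) ≠ 0 := by exact_mod_cast Real.pi_ne_zero
    push_cast
    generalize ∫ k : ℝ, (Fhat k : ℂ) *
      (Real.sinc (k / c * d) : ℂ) * Complex.exp (Complex.I * k * t) = J
    field_simp
  · have hfin : IsFiniteMeasure ((volume : Measure ℝ).restrict (Set.uIoc (-1 : ℝ) 1)) := by
      rw [Set.uIoc_of_le (by norm_num)]
      infer_instance
    have h1 : Integrable (fun p : ℝ × ℝ => (Fhat p.2 : ℂ))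
        ((volume.restrict (Set.uIoc (-1 : ℝ) 1)).prod volume) :=
      (hFhat.ofReal (𝕜 := ℂ)).comp_snd _
    refine h1.mul_bdd (c := 1) (Continuous.aestronglyMeasurable (by fun_prop)) ?_
    exact Eventually.of_forall fun p => (Complex.norm_exp_ofReal_mul_I _).le

end

/-! ### The Rindler trajectory and the conclusion -/

theorem rindlerPos_apply_two_pos {c ξ α ξ₀ : ℝ} (hξ : 0 < ξ)
    (hα : α ∈ Set.Ioo (-(Real.pi / 2)) (Real.pi / 2)) (hξ₀ : -(ξ * Real.cos α) < ξ₀) (s : ℝ) :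
    0 < rindlerPos c ξ α ξ₀ s 2 := by
  have h1 : 0 < Real.cos α := Real.cos_pos_of_mem_Ioo hα
  have h2 : 1 ≤ Real.cosh (c * s / ξ) := Real.one_le_cosh _
  have h3 : rindlerPos c ξ α ξ₀ s 2 = ξ₀ + ξ * Real.cosh (c * s / ξ) * Real.cos α := by
    simp [rindlerPos]
  rw [h3]
  have : ξ * Real.cos α ≤ ξ * Real.cosh (c * s / ξ) * Real.cos α := by
    gcongr
    exact le_mul_of_one_le_right hξ.le h2
  linarith

theorem rindlerMirrorPos_eq (c ξ α ξ₀ s : ℝ) :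
    rindlerMirrorPos c ξ α ξ₀ s = mirror (rindlerPos c ξ α ξ₀ s) := by
  ext i
  fin_cases i <;> simp [rindlerMirrorPos, rindlerPos]

end

/-- The autocorrelation of the signal recorded by a Rindler observer in front of a Dirichlet
plane, for noise sources on a half-sphere whose radius `L` tends to infinity. -/
theorem proposition6
    -- parameters of the medium and of the trajectory
    (c ξ α ξ₀ : ℝ) (hc : 0 < c) (hξ : 0 < ξ)
    (hα : α ∈ Set.Ioo (-(Real.pi / 2)) (Real.pi / 2)) (hξ₀ : -(ξ * Real.cos α) < ξ₀)
    -- time covariance `F` of the sources and its power spectral density `Fhat`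
    (F Fhat : ℝ → ℝ) (hFhat : Integrable Fhat)
    (hF : ∀ t : ℝ, (F t : ℂ) =
      1 / (2 * (Real.pi : ℂ)) * ∫ k : ℝ, (Fhat k : ℂ) * Complex.exp (-(Complex.I * k * t)))
    -- for every radius `L`, a noise source on the half-sphere and the field that it emits
    (Ω : ℝ → Type*) [∀ L, MeasurableSpace (Ω L)] (P : ∀ L, Measure (Ω L))
    [∀ L, IsProbabilityMeasure (P L)]
    (n : ∀ L, (ℝ × Space3 → ℝ) → Lp ℝ 2 (P L)) (u : ∀ L, ℝ → Space3 → Lp ℝ 2 (P L))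
    (hn : ∀ L, 0 < L → IsNoiseSource (P L) F L (n L))
    (hu : ∀ L, 0 < L → IsCausalWaveField c L (n L) (u L))
    (τ τ' : ℝ) :
    -- elapsed laboratory time, distance travelled, and distance from the mirror image
    let t : ℝ := rindlerTime c ξ (τ + τ' / 2) - rindlerTime c ξ (τ - τ' / 2)
    let d : ℝ := ‖rindlerPos c ξ α ξ₀ (τ + τ' / 2) - rindlerPos c ξ α ξ₀ (τ - τ' / 2)‖
    let dm : ℝ := ‖rindlerMirrorPos c ξ α ξ₀ (τ + τ' / 2) - rindlerPos c ξ α ξ₀ (τ - τ' / 2)‖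
    Tendsto
        (fun L => ((autocorrelation (recordedSignal (u L) c ξ α ξ₀) τ τ' : ℝ) : ℂ)) atTop
        (𝓝 (sincIntegral Fhat c d t - sincIntegral Fhat c dm t)) ∧
      Tendsto
        (fun L => autocorrelation (recordedSignal (u L) c ξ α ξ₀) τ τ') atTop
        (𝓝 (1 / (8 * Real.pi) * (∫ v in (-1 : ℝ)..1, F (v / c * d + t))
          - 1 / (8 * Real.pi) * (∫ v in (-1 : ℝ)..1, F (v / c * dm + t)))) := by
  intro t d dm
  have hFc := continuous_of_spectral hFhat hF
  have hFb := abs_le_of_spectral hF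
  set x := rindlerPos c ξ α ξ₀ (τ + τ' / 2) with hx
  set x' := rindlerPos c ξ α ξ₀ (τ - τ' / 2) with hx'
  have hdm : dm = ‖mirror x - x'‖ := by rw [hx, ← rindlerMirrorPos_eq]
  have hlim := tendsto_integral_sourceCovariance_images (fun v => F (t + v / c)) (by fun_prop)
    (fun v => hFb _) x x'
  have e : ∀ δ : ℝ, ∫ v in (-1 : ℝ)..1, F (t + v * δ / c) =
      ∫ v in (-1 : ℝ)..1, F (v / c * δ + t) := by
    intro δ
    refine intervalIntegral.integral_congr fun v _ => ?_
    congr 1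
    ring
  have hreal : Tendsto
      (fun L => autocorrelation (recordedSignal (u L) c ξ α ξ₀) τ τ') atTop
      (𝓝 (1 / (8 * Real.pi) * (∫ v in (-1 : ℝ)..1, F (v / c * d + t))
        - 1 / (8 * Real.pi) * (∫ v in (-1 : ℝ)..1, F (v / c * dm + t)))) := by
    rw [hdm, ← e, ← e]
    refine hlim.congr' ?_
    -- Beyond these radii both observation points lie inside the half-sphere of sources, where the
    -- covariance formula is exact.
    filter_upwards [eventually_gt_atTop 0, eventually_gt_atTop ‖x‖, eventually_gt_atTop ‖x'‖]
      with L hL h1 h2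
    exact (integral_field_mul_field hc hFc hFb hL (hn L hL) (hu L hL) _ _
      (rindlerPos_apply_two_pos hξ hα hξ₀ _) (rindlerPos_apply_two_pos hξ hα hξ₀ _) h1 h2).symm
  refine ⟨?_, hreal⟩
  rw [sincIntegral_eq hFhat hF, sincIntegral_eq hFhat hF, ← Complex.ofReal_sub]
  exact (Complex.continuous_ofReal.tendsto _).comp hreal
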